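/- Let $k$ be an algebraically closed field of characteristic $p>2$, let $n$ be a positive integer with $p\mid n$, and let $\lambda,\mu\in k$. Let $H(\lambda,\mu)$ be the Hopf algebra over $k$ which is generated as an algebra by $g,a,b$ with the relations $$g^n=1,\quad g^{-1}ag=a,\quad g^{-1}bg=a+b,\quad a^p=\lambda(1-g^p),\quad b^p=\mu(1-g^p),\quad ba=ab+\tfrac12a^2,$$ and whose comultiplication, counit and antipode are determined by $$\Delta(g)=g\otimes g,\quad \Delta(a)=a\otimes 1+g\otimes a,\quad \Delta(b)=b\otimes 1+g\otimes b,$$ $$\varepsilon(g)=1,\quad \varepsilon(a)=\varepsilon(b)=0,\qquad S(g)=g^{-1},\quad S(a)=-g^{-1}a,\quad S(b)=-g^{-1}b.$$ Then $H(\lambda,\mu)$ is a symmetric algebra, that is, it is finite dimensional and there is a nondegenerate $k$-bilinear form $\beta:H(\lambda,\mu)\times H(\lambda,\mu)\to k$ with $\beta(xy,z)=\beta(x,yz)$ and $\beta(x,y)=\beta(y,x)$ for all $x,y,z$. Moreover, the element $t=\big(\sum_{i=0}^{n-1}g^i\big)a^{p-1}b^{p-1}$ is nonzero, and both the space of left integrals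 $\{x : hx=\varepsilon(h)x \text{ for all } h\}$ and the space of right integrals $\{x : xh=\varepsilon(h)x\text{ for all } h\}$ are equal to $kt$; in particular, $H(\lambda,\mu)$ is unimodular (the two spaces coincide). Furthermore, $S^2$ is inner, that is, there is a unit $v$ of $H(\lambda,\mu)$ with $S^2(x)=vxv^{-1}$ for all $x$. -/

import Mathlib

open scoped TensorProduct

universe u

/-! ### Symmetric algebras, integrals, unimodularity, inner maps -/

/-- A finite-dimensional `k`-algebra `A` is symmetric if it carries a nondegenerate `k`-bilinear
form which is associative and symmetric. -/
def IsSymmetricAlg (k A : Type*) [Field k] [Ring A] [Algebra k A] : Prop :=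
  FiniteDimensional k A ∧
    ∃ β : LinearMap.BilinForm k A, β.Nondegenerate ∧
      (∀ x y z : A, β (x * y) z = β x (y * z)) ∧ (∀ x y : A, β x y = β y x)

/-- The space of left integrals of a Hopf algebra. -/
def leftIntegrals (k A : Type*) [Field k] [Ring A] [HopfAlgebra k A] : Submodule k A where
  carrier := {t | ∀ h : A, h * t = Coalgebra.counit (R := k) h • t}
  zero_mem' := by intro h; simp
  add_mem' := by intro x y hx hy h; rw [mul_add, hx h, hy h, smul_add]
  smul_mem' := by intro c x hx h; rw [mul_smul_comm, hx h, smul_comm]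

/-- The space of right integrals of a Hopf algebra. -/
def rightIntegrals (k A : Type*) [Field k] [Ring A] [HopfAlgebra k A] : Submodule k A where
  carrier := {t | ∀ h : A, t * h = Coalgebra.counit (R := k) h • t}
  zero_mem' := by intro h; simp
  add_mem' := by intro x y hx hy h; rw [add_mul, hx h, hy h, smul_add]
  smul_mem' := by intro c x hx h; rw [smul_mul_assoc, hx h, smul_comm]

/-- A Hopf algebra is unimodular if its left and right integrals coincide. -/
def IsUnimodular (k A : Type*) [Field k] [Ring A] [HopfAlgebra k A] : Prop :=
  leftIntegrals k A = rightIntegrals k A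

/-- A self-map of a ring is inner if it is conjugation by a unit. -/
def IsInnerMap {A : Type*} [Ring A] (f : A → A) : Prop :=
  ∃ v : Aˣ, ∀ x : A, f x = (v : A) * x * ((v⁻¹ : Aˣ) : A)

/-! ### The algebra `H(λ, μ)` by generators and relations -/

/-- The three generators. -/
inductive LiftGen : Type
  | g | a | b

section Relations

variable (k : Type u) [Field k]

/-- The defining relations. Since `g ^ n = 1` with `n > 0`, the element `g` is invertible, and the
relations `g⁻¹ a g = a` and `g⁻¹ b g = a + b` are written as `a g = g a` and `b g = g (a + b)`. -/
inductive LiftRel (p n : ℕ) (lam mu : k) :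
    FreeAlgebra k LiftGen → FreeAlgebra k LiftGen → Prop
  | g_pow : LiftRel p n lam mu (FreeAlgebra.ι k LiftGen.g ^ n) 1
  | a_g : LiftRel p n lam mu (FreeAlgebra.ι k LiftGen.a * FreeAlgebra.ι k LiftGen.g)
      (FreeAlgebra.ι k LiftGen.g * FreeAlgebra.ι k LiftGen.a)
  | b_g : LiftRel p n lam mu (FreeAlgebra.ι k LiftGen.b * FreeAlgebra.ι k LiftGen.g)
      (FreeAlgebra.ι k LiftGen.g * (FreeAlgebra.ι k LiftGen.a + FreeAlgebra.ι k LiftGen.b))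
  | a_pow : LiftRel p n lam mu (FreeAlgebra.ι k LiftGen.a ^ p)
      (lam • (1 - FreeAlgebra.ι k LiftGen.g ^ p))
  | b_pow : LiftRel p n lam mu (FreeAlgebra.ι k LiftGen.b ^ p)
      (mu • (1 - FreeAlgebra.ι k LiftGen.g ^ p))
  | b_a : LiftRel p n lam mu (FreeAlgebra.ι k LiftGen.b * FreeAlgebra.ι k LiftGen.a)
      (FreeAlgebra.ι k LiftGen.a * FreeAlgebra.ι k LiftGen.b
        + (1 / 2 : k) • FreeAlgebra.ι k LiftGen.a ^ 2)

/-- The algebra `H(λ, μ)`. -/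
def LiftAlg (p n : ℕ) (lam mu : k) : Type u :=
  RingQuot (LiftRel k p n lam mu)

end Relations

namespace LiftAlg

noncomputable section

variable {k : Type u} [Field k] {p n : ℕ} {lam mu : k}

instance : Ring (LiftAlg k p n lam mu) :=
  inferInstanceAs (Ring (RingQuot (LiftRel k p n lam mu)))

instance : Algebra k (LiftAlg k p n lam mu) :=
  inferInstanceAs (Algebra k (RingQuot (LiftRel k p n lam mu)))

/-- The quotient map from the free algebra. -/
def mk (k : Type u) [Field k] (p n : ℕ) (lam mu : k) :
    FreeAlgebra k LiftGen →ₐ[k] LiftAlg k p n lam mu :=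
  RingQuot.mkAlgHom k (LiftRel k p n lam mu)

variable (k p n lam mu) in
/-- The generator `g` of `H(λ, μ)`. -/
def g : LiftAlg k p n lam mu := mk k p n lam mu (FreeAlgebra.ι k LiftGen.g)

variable (k p n lam mu) in
/-- The generator `a` of `H(λ, μ)`. -/
def a : LiftAlg k p n lam mu := mk k p n lam mu (FreeAlgebra.ι k LiftGen.a)

variable (k p n lam mu) in
/-- The generator `b` of `H(λ, μ)`. -/
def b : LiftAlg k p n lam mu := mk k p n lam mu (FreeAlgebra.ι k LiftGen.b)

lemma mk_rel {x y : FreeAlgebra k LiftGen} (h : LiftRel k p n lam mu x y) :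
    mk k p n lam mu x = mk k p n lam mu y :=
  RingQuot.mkAlgHom_rel k h

/-- The relations hold for three elements of a `k`-algebra. -/
structure Good (p n : ℕ) (lam mu : k) {R : Type*} [Ring R] [Algebra k R] (g a b : R) : Prop where
  g_pow : g ^ n = 1
  a_g : a * g = g * a
  b_g : b * g = g * (a + b)
  a_pow : a ^ p = lam • (1 - g ^ p)
  b_pow : b ^ p = mu • (1 - g ^ p)
  b_a : b * a = a * b + (1 / 2 : k) • a ^ 2

lemma good : Good p n lam mu (g k p n lam mu) (a k p n lam mu) (b k p n lam mu) where
  g_pow := by simpa [g, a, b] using mk_rel (LiftRel.g_pow (p := p) (n := n) (lam := lam) (mu := mu))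
  a_g := by simpa [g, a, b] using mk_rel (LiftRel.a_g (p := p) (n := n) (lam := lam) (mu := mu))
  b_g := by simpa [g, a, b] using mk_rel (LiftRel.b_g (p := p) (n := n) (lam := lam) (mu := mu))
  a_pow := by simpa [g, a, b] using mk_rel (LiftRel.a_pow (p := p) (n := n) (lam := lam) (mu := mu))
  b_pow := by simpa [g, a, b] using mk_rel (LiftRel.b_pow (p := p) (n := n) (lam := lam) (mu := mu))
  b_a := by simpa [g, a, b] using mk_rel (LiftRel.b_a (p := p) (n := n) (lam := lam) (mu := mu))

section Lift

variable {R : Type*} [Ring R] [Algebra k R]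

/-- Assignment of values to the three generators. -/
def vals (x y z : R) : LiftGen → R
  | .g => x
  | .a => y
  | .b => z

/-- The universal property: three elements satisfying the relations define an algebra map. -/
def lift {x y z : R} (h : Good p n lam mu x y z) : LiftAlg k p n lam mu →ₐ[k] R :=
  RingQuot.liftAlgHom k ⟨FreeAlgebra.lift k (vals x y z), by
    intro s t hst
    cases hst
    · simpa [vals] using h.g_pow
    · simpa [vals] using h.a_g
    · simpa [vals] using h.b_g
    · simpa [vals] using h.a_pow
    · simpa [vals] using h.b_pow
    · simpa [vals] using h.b_a⟩

lemma lift_mk {x y z : R} (h : Good p n lam mu x y z) (w : FreeAlgebra k LiftGen) :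
    lift h (mk k p n lam mu w) = FreeAlgebra.lift k (vals x y z) w :=
  RingQuot.liftAlgHom_mkAlgHom_apply k _ _ _

@[simp] lemma lift_g {x y z : R} (h : Good p n lam mu x y z) : lift h (g k p n lam mu) = x := by
  rw [g, lift_mk]; simp [vals]

@[simp] lemma lift_a {x y z : R} (h : Good p n lam mu x y z) : lift h (a k p n lam mu) = y := by
  rw [a, lift_mk]; simp [vals]

@[simp] lemma lift_b {x y z : R} (h : Good p n lam mu x y z) : lift h (b k p n lam mu) = z := by
  rw [b, lift_mk]; simp [vals]

lemma mk_surjective : Function.Surjective (mk k p n lam mu) :=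
  RingQuot.mkAlgHom_surjective k _

lemma hom_ext {f f' : LiftAlg k p n lam mu →ₐ[k] R} (hg : f (g k p n lam mu) = f' (g k p n lam mu))
    (ha : f (a k p n lam mu) = f' (a k p n lam mu))
    (hb : f (b k p n lam mu) = f' (b k p n lam mu)) : f = f' := by
  have key : f.comp (mk k p n lam mu) = f'.comp (mk k p n lam mu) := by
    apply FreeAlgebra.hom_ext
    funext i
    cases i
    · exact hg
    · exact ha
    · exact hb
  apply AlgHom.ext
  intro x
  obtain ⟨w, rfl⟩ := mk_surjective x
  exact AlgHom.congr_fun key w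

end Lift

/-! ### Auxiliary computations: `p`-th powers -/

/-- Unsigned Lah numbers. -/
def lah : ℕ → ℕ → ℕ
  | 0, 0 => 1
  | 0, _ + 1 => 0
  | m + 1, 0 => m * lah m 0
  | m + 1, j + 1 => lah m j + (m + (j + 1)) * lah m (j + 1)

lemma lah_zero_right (m : ℕ) : lah (m + 1) 0 = 0 := by
  induction m with
  | zero => simp [lah]
  | succ m ih => rw [lah, ih, mul_zero]

lemma lah_eq_zero : ∀ (m j : ℕ), m < j → lah m j = 0
  | 0, j + 1, _ => rfl
  | m + 1, j + 1, h => by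
      rw [lah, lah_eq_zero m j (by omega), lah_eq_zero m (j + 1) (by omega)]; simp

lemma lah_self (m : ℕ) : lah m m = 1 := by
  induction m with
  | zero => rfl
  | succ m ih => rw [lah, ih, lah_eq_zero m (m + 1) (by omega)]; simp

lemma lah_mul_factorial (m j : ℕ) :
    lah (m + 1) (j + 1) * (j + 1).factorial = m.choose j * (m + 1).factorial := by
  induction m generalizing j with
  | zero =>
    cases j with
    | zero => simp [lah]
    | succ j => simp [lah]
  | succ m ih =>
    rw [lah, add_mul, mul_assoc, ih j]
    cases j with
    | zero =>
      rw [lah_zero_right]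
      simp [Nat.factorial_succ]
    | succ j =>
      rw [Nat.factorial_succ (j + 1)]
      have h1 := ih j
      have h2 : lah (m + 1) (j + 1) * ((j + 1 + 1) * (j + 1).factorial)
          = (j + 2) * (m.choose j * (m + 1).factorial) := by rw [← h1]; ring
      rw [h2, Nat.choose_succ_succ, Nat.factorial_succ (m + 1)]
      have h3 : m.choose (j + 1) * (j + 1) + m.choose j * j = m.choose j * m := by
        rw [Nat.choose_succ_right_eq]
        rcases Nat.lt_or_ge m j with h | h
        · simp [Nat.choose_eq_zero_of_lt h]
        · rw [← mul_add, Nat.sub_add_cancel h]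
      have h4 : (m.choose (j + 1) * (j + 1) + m.choose j * j) * (m + 1).factorial
          = m.choose j * m * (m + 1).factorial := by rw [h3]
      linear_combination h4

lemma dvd_lah (hp : p.Prime) {j : ℕ} (hj : j < p) : p ∣ lah p j := by
  obtain ⟨m, rfl⟩ : ∃ m, p = m + 1 := ⟨p - 1, by have := hp.pos; omega⟩
  cases j with
  | zero => simp [lah_zero_right]
  | succ j =>
    have h := lah_mul_factorial m j
    have h1 : (m + 1) ∣ lah (m + 1) (j + 1) * (j + 1).factorial := by
      rw [h]; exact Dvd.dvd.mul_left (Nat.dvd_factorial (Nat.succ_pos m) le_rfl) _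
    rcases hp.dvd_mul.1 h1 with h2 | h2
    · exact h2
    · have := (hp.dvd_factorial).1 h2; omega

section Powers

variable {R : Type*} [Ring R]

/-- The Lah sum. -/
def lahSum (e : ℕ → ℕ → R) (m : ℕ) : R :=
  ∑ i ∈ Finset.range (m + 1), (lah m i : R) * e i (m - i)

lemma lahSum_succ (e : ℕ → ℕ → R) (m : ℕ) (T : R →+ R)
    (hT : ∀ i ≤ m, T (e i (m - i)) = e (i + 1) (m - i) + ((m + i : ℕ) : R) * e i (m - i + 1)) :
    T (lahSum e m) = lahSum e (m + 1) := by
  have hT2 : ∀ (c : ℕ) (x : R), T ((c : R) * x) = (c : R) * T x := by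
    intro c x
    rw [← nsmul_eq_mul, map_nsmul, nsmul_eq_mul]
  rw [lahSum, lahSum, map_sum, Finset.sum_range_succ' _ (m + 1)]
  have h1 : ∑ i ∈ Finset.range (m + 1), T ((lah m i : R) * e i (m - i))
      = ∑ i ∈ Finset.range (m + 1), (lah m i : R) * e (i + 1) (m - i)
        + ∑ i ∈ Finset.range (m + 1), (((m + i) * lah m i : ℕ) : R) * e i (m + 1 - i) := by
    rw [← Finset.sum_add_distrib]
    refine Finset.sum_congr rfl fun i hi => ?_
    have hi' : i ≤ m := by simpa [Nat.lt_succ_iff] using hi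
    rw [hT2, hT i hi', mul_add, ← mul_assoc, ← Nat.cast_mul, mul_comm (lah m i),
      Nat.sub_add_comm hi']
  have h2 : ∑ i ∈ Finset.range (m + 1), (((m + i) * lah m i : ℕ) : R) * e i (m + 1 - i)
      = ∑ i ∈ Finset.range (m + 1),
          (((m + (i + 1)) * lah m (i + 1) : ℕ) : R) * e (i + 1) (m - i)
        + ((m * lah m 0 : ℕ) : R) * e 0 (m + 1) := by
    have h3 := Finset.sum_range_succ
      (fun i => (((m + i) * lah m i : ℕ) : R) * e i (m + 1 - i)) (m + 1)
    rw [lah_eq_zero m (m + 1) (by omega)] at h3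
    simp only [mul_zero, Nat.cast_zero, zero_mul, add_zero] at h3
    rw [← h3, Finset.sum_range_succ']
    simp
  rw [h1, h2, ← add_assoc, ← Finset.sum_add_distrib]
  congr 1
  refine Finset.sum_congr rfl fun i _ => ?_
  rw [← add_mul, ← Nat.cast_add, lah, Nat.add_sub_add_right]

lemma lahSum_prime (hpR : (p : R) = 0) (hp : p.Prime) (e : ℕ → ℕ → R) : lahSum e p = e p 0 := by
  rw [lahSum, Finset.sum_range_succ, Finset.sum_eq_zero, lah_self]
  · simp
  · intro i hi
    obtain ⟨c, hc⟩ := dvd_lah hp (j := i) (by simpa using hi)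
    rw [hc, Nat.cast_mul, hpR, zero_mul, zero_mul]

lemma mul_pow_left_comm {x w : R} (hxw : x * w = w * x + w * w) (m : ℕ) :
    x * w ^ m = w ^ m * x + (m : R) * w ^ (m + 1) := by
  induction m with
  | zero => simp
  | succ m ih =>
    rw [pow_succ w m, ← mul_assoc, ih, add_mul, mul_assoc, hxw]
    push_cast
    noncomm_ring

lemma add_pow_p (hpR : (p : R) = 0) (hp : p.Prime) {x y w : R} (hyw : Commute y w)
    (hxw : x * w = w * x + w * w) (hxy : x * y = y * x + 2 * (y * w)) :
    (x + y) ^ p = x ^ p + y ^ p := by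
  have hxy' : ∀ j : ℕ, x * y ^ j = y ^ j * x + (2 * j : ℕ) * (y ^ j * w) := by
    intro j
    induction j with
    | zero => simp
    | succ j ih =>
      have : w * y = y * w := hyw.eq.symm
      rw [pow_succ, ← mul_assoc, ih, add_mul, mul_assoc (y ^ j) x, hxy, mul_assoc _ _ y,
        mul_assoc _ w y, this]
      push_cast
      noncomm_ring
  let L : R → Module.End ℤ R := fun r => (LinearMap.mulLeft ℤ r)
  let Rx : Module.End ℤ R := LinearMap.mulRight ℤ x
  let T : Module.End ℤ R := L (x + y) - Rx
  have hc : Commute T Rx := by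
    refine LinearMap.ext fun z => ?_
    simp only [T, Rx, L, Module.End.mul_apply, LinearMap.sub_apply, LinearMap.mulLeft_apply,
      LinearMap.mulRight_apply]
    noncomm_ring
  have hT : ∀ m, (T ^ m) 1 = lahSum (fun i j => y ^ i * w ^ j) m := by
    intro m
    induction m with
    | zero => simp [lahSum, lah]
    | succ m ih =>
      rw [pow_succ', Module.End.mul_apply, ih]
      apply lahSum_succ _ m T.toAddMonoidHom
      intro i hi
      have e1 : m + i = 2 * i + (m - i) := by omega
      rw [e1]
      generalize m - i = j
      simp only [LinearMap.toAddMonoidHom_coe, T, Rx, L, LinearMap.sub_apply,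
        LinearMap.mulLeft_apply, LinearMap.mulRight_apply]
      rw [add_mul, ← mul_assoc x, hxy' i, add_mul, mul_assoc _ x, mul_pow_left_comm hxw j]
      have e2 : y * (y ^ i * w ^ j) = y ^ (i + 1) * w ^ j := by rw [← mul_assoc, ← pow_succ']
      have e3 : ((2 * i : ℕ) : R) * (y ^ i * w) * w ^ j
          = ((2 * i : ℕ) : R) * (y ^ i * w ^ (j + 1)) := by rw [pow_succ' w]; noncomm_ring
      have e4 : y ^ i * ((j : R) * w ^ (j + 1)) = (j : R) * (y ^ i * w ^ (j + 1)) := by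
        rw [← mul_assoc, ← Nat.cast_comm, mul_assoc]
      rw [e2, e3, mul_add, e4, Nat.cast_add, add_mul, mul_assoc (y ^ i)]
      abel
  obtain ⟨r, hr⟩ : ∃ r, (L (x + y)) ^ p = T ^ p + Rx ^ p + (p : Module.End ℤ R) * r := by
    obtain ⟨r, hr⟩ := hc.exists_add_pow_prime_eq hp
    refine ⟨T * Rx * r, ?_⟩
    rw [← mul_assoc, ← mul_assoc, ← hr]
    simp [T]
  have h1 := LinearMap.congr_fun hr 1
  have hL : ((L (x + y)) ^ p) 1 = (x + y) ^ p := by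
    simp only [L, LinearMap.pow_mulLeft, LinearMap.mulLeft_apply, mul_one]
  have hR : (Rx ^ p) 1 = x ^ p := by
    simp only [Rx, LinearMap.pow_mulRight, LinearMap.mulRight_apply, one_mul]
  rw [hL, LinearMap.add_apply, LinearMap.add_apply, hR, hT, lahSum_prime hpR hp,
    Module.End.mul_apply, Module.End.natCast_apply, nsmul_eq_mul, hpR] at h1
  rw [h1]
  simp [add_comm]

lemma inv_mul_pow_p (hpR : (p : R) = 0) (hp : p.Prime) {h x v : R} (hhv : Commute h v)
    (hxv : x * v = v * x - v * v) (hxh : x * h = h * (x + 2 * v)) :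
    (h * x) ^ p = h ^ p * x ^ p := by
  have hxv' : ∀ m : ℕ, x * v ^ m = v ^ m * x - (m : R) * v ^ (m + 1) := by
    intro m
    induction m with
    | zero => simp
    | succ m ih =>
      rw [pow_succ v m, ← mul_assoc, ih, sub_mul, mul_assoc, hxv]
      push_cast
      noncomm_ring
  have hxh' : ∀ m : ℕ, x * h ^ m = h ^ m * (x + (2 * m : ℕ) * v) := by
    intro m
    induction m with
    | zero => simp
    | succ m ih =>
      have hvh : v * h = h * v := hhv.eq.symm
      rw [pow_succ h m, ← mul_assoc, ih, mul_assoc, add_mul, hxh, mul_assoc _ v h, hvh]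
      push_cast
      have hm : (m : R) * (h * v) = h * ((m : R) * v) := (Nat.cast_commute m h).left_comm v
      have hm2 : h ^ m * ((m : R) * (h * v)) = h ^ m * (h * ((m : R) * v)) := by rw [hm]
      noncomm_ring
      rw [hm2]
  have key : ∀ m, (h * x) ^ m = h ^ m * lahSum (fun i j => v ^ j * x ^ i) m := by
    intro m
    induction m with
    | zero => simp [lahSum, lah]
    | succ m ih =>
      rw [pow_succ', ih, mul_assoc, ← mul_assoc x, hxh', mul_assoc (h ^ m), ← mul_assoc h,
        ← pow_succ']
      congr 1
      apply lahSum_succ _ m (AddMonoidHom.mulLeft (x + ((2 * m : ℕ) : R) * v))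
      intro i hi
      obtain ⟨j, rfl⟩ := Nat.exists_eq_add_of_le hi
      rw [Nat.add_sub_cancel_left]
      simp only [AddMonoidHom.coe_mulLeft]
      rw [add_mul, ← mul_assoc x, hxv', mul_assoc _ v, ← mul_assoc v, ← pow_succ', sub_mul,
        mul_assoc _ x, ← pow_succ', mul_assoc (j : R)]
      push_cast
      noncomm_ring
  rw [key, lahSum_prime hpR hp]
  simp

end Powers

/-! ### The Hopf algebra structure -/

section Hopf

variable {R : Type*} [Ring R] [Algebra k R]

lemma two_ne_of_char (k : Type u) [Field k] (p : ℕ) [CharP k p] (hp : 2 < p) : (2 : k) ≠ 0 := by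
  intro h
  have h1 : p ∣ 2 := (CharP.cast_eq_zero_iff k p 2).1 (by exact_mod_cast h)
  have := Nat.le_of_dvd (by norm_num) h1
  omega

lemma natCast_p_eq_zero (k : Type u) [Field k] (p : ℕ) [CharP k p] (R : Type*) [Ring R]
    [Algebra k R] : (p : R) = 0 := by
  rw [← map_natCast (algebraMap k R), CharP.cast_eq_zero, map_zero]

lemma two_mul_half (h2 : (2 : k) ≠ 0) (x : R) : 2 * ((1 / 2 : k) • x) = x := by
  have : NeZero (2 : k) := ⟨h2⟩
  rw [two_mul, ← add_smul, add_halves, one_smul]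

/-- The values of the comultiplication on the generators satisfy the relations. -/
lemma good_comul [Fact p.Prime] [CharP k p] [Fact (2 < p)] {x y z : R}
    (h : Good p n lam mu x y z) :
    Good p n lam mu (x ⊗ₜ[k] x) (y ⊗ₜ[k] (1 : R) + x ⊗ₜ[k] y) (z ⊗ₜ[k] (1 : R) + x ⊗ₜ[k] z) := by
  have hp : p.Prime := Fact.out
  have h2 : (2 : k) ≠ 0 := two_ne_of_char k p Fact.out
  have : NeZero (2 : k) := ⟨h2⟩
  have hpT : (p : R ⊗[k] R) = 0 := natCast_p_eq_zero k p _
  refine ⟨?_, ?_, ?_, ?_, ?_, ?_⟩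
  · rw [Algebra.TensorProduct.tmul_pow, h.g_pow, Algebra.TensorProduct.one_def]
  · simp only [mul_add, add_mul, Algebra.TensorProduct.tmul_mul_tmul, h.a_g, one_mul, mul_one]
  · simp only [mul_add, add_mul, Algebra.TensorProduct.tmul_mul_tmul, h.b_g, one_mul, mul_one,
      TensorProduct.add_tmul, TensorProduct.tmul_add]
    abel
  · have hc : Commute (y ⊗ₜ[k] (1 : R)) (x ⊗ₜ[k] y) := by
      simp only [Commute, SemiconjBy, Algebra.TensorProduct.tmul_mul_tmul, h.a_g, one_mul, mul_one]
    obtain ⟨r, hr⟩ := hc.exists_add_pow_prime_eq hp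
    rw [hr, hpT]
    simp only [Algebra.TensorProduct.tmul_pow, h.a_pow, one_pow, Algebra.TensorProduct.one_def,
      TensorProduct.sub_tmul, TensorProduct.tmul_sub, TensorProduct.tmul_smul,
      ← TensorProduct.smul_tmul', zero_mul]
    module
  · rw [add_pow_p hpT hp (w := ((1 / 2 : k) • y) ⊗ₜ[k] (1 : R))]
    · simp only [Algebra.TensorProduct.tmul_pow, h.b_pow, one_pow, Algebra.TensorProduct.one_def,
        TensorProduct.sub_tmul, TensorProduct.tmul_sub, TensorProduct.tmul_smul,
        ← TensorProduct.smul_tmul']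
      module
    · simp only [Commute, SemiconjBy, Algebra.TensorProduct.tmul_mul_tmul, smul_mul_assoc,
        mul_smul_comm, h.a_g, one_mul, mul_one]
    · simp only [Algebra.TensorProduct.tmul_mul_tmul, smul_mul_assoc, mul_smul_comm, h.b_a,
        mul_one, ← TensorProduct.smul_tmul', TensorProduct.add_tmul, pow_two, smul_add]
    · simp only [Algebra.TensorProduct.tmul_mul_tmul, mul_smul_comm, h.b_g, one_mul, mul_one,
        ← TensorProduct.smul_tmul', two_mul_half h2, mul_add, TensorProduct.add_tmul]
      abel
  · simp only [mul_add, add_mul, Algebra.TensorProduct.tmul_mul_tmul, h.b_a, h.a_g, h.b_g, one_mul,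
      mul_one, pow_two, TensorProduct.add_tmul, TensorProduct.tmul_add, TensorProduct.tmul_smul,
      ← TensorProduct.smul_tmul', smul_add]
    have e : (x * y) ⊗ₜ[k] y = (1 / 2 : k) • ((x * y) ⊗ₜ[k] y) + (1 / 2 : k) • ((x * y) ⊗ₜ[k] y) := by
      rw [← add_smul, add_halves, one_smul]
    nth_rewrite 1 [e]
    abel

/-- The values of the counit on the generators satisfy the relations. -/
lemma good_counit [Fact p.Prime] : Good p n lam mu (1 : k) 0 0 where
  g_pow := one_pow n
  a_g := by simp
  b_g := by simp
  a_pow := by simp [(Fact.out : p.Prime).ne_zero]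
  b_pow := by simp [(Fact.out : p.Prime).ne_zero]
  b_a := by simp

instance [Fact p.Prime] [CharP k p] [Fact (2 < p)] : Bialgebra k (LiftAlg k p n lam mu) :=
  Bialgebra.ofAlgHom (lift (good_comul good)) (lift good_counit)
    (by
      apply hom_ext <;>
      simp [Algebra.TensorProduct.one_def, TensorProduct.add_tmul, TensorProduct.tmul_add,
        add_assoc])
    (by apply hom_ext <;> simp)
    (by apply hom_ext <;> simp)

section Values

variable [Fact p.Prime] [CharP k p] [Fact (2 < p)]

lemma comul_g : Coalgebra.comul (R := k) (g k p n lam mu) =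
    g k p n lam mu ⊗ₜ[k] g k p n lam mu :=
  lift_g (good_comul good)

lemma comul_a : Coalgebra.comul (R := k) (a k p n lam mu) =
    a k p n lam mu ⊗ₜ[k] 1 + g k p n lam mu ⊗ₜ[k] a k p n lam mu :=
  lift_a (good_comul good)

lemma comul_b : Coalgebra.comul (R := k) (b k p n lam mu) =
    b k p n lam mu ⊗ₜ[k] 1 + g k p n lam mu ⊗ₜ[k] b k p n lam mu :=
  lift_b (good_comul good)

lemma counit_g : Coalgebra.counit (R := k) (g k p n lam mu) = 1 :=
  lift_g good_counit

lemma counit_a : Coalgebra.counit (R := k) (a k p n lam mu) = 0 :=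
  lift_a good_counit

lemma counit_b : Coalgebra.counit (R := k) (b k p n lam mu) = 0 :=
  lift_b good_counit

end Values

/-- The values of the antipode on the generators satisfy the relations in the opposite algebra. -/
lemma good_antipode [Fact p.Prime] [CharP k p] [Fact (2 < p)] [NeZero n] {x y z : R}
    (h : Good p n lam mu x y z) :
    Good p n lam mu (MulOpposite.op (x ^ (n - 1))) (MulOpposite.op (-(x ^ (n - 1) * y)))
      (MulOpposite.op (-(x ^ (n - 1) * z))) := by
  have hp : p.Prime := Fact.out
  have hodd : Odd p := hp.odd_of_ne_two (by have := (Fact.out : 2 < p); omega)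
  have h2 : (2 : k) ≠ 0 := two_ne_of_char k p Fact.out
  have : NeZero (2 : k) := ⟨h2⟩
  have hn : n ≠ 0 := NeZero.ne n
  have hx : x ^ (n - 1) * x = 1 := by rw [← pow_succ, Nat.sub_add_cancel (by omega), h.g_pow]
  have hx' : x * x ^ (n - 1) = 1 := by rw [← pow_succ', Nat.sub_add_cancel (by omega), h.g_pow]
  have hi : (x ^ (n - 1)) ^ n = 1 := by rw [← pow_mul, mul_comm, pow_mul, h.g_pow, one_pow]
  generalize x ^ (n - 1) = i at *
  have hiy : y * i = i * y := by
    calc y * i = i * x * (y * i) := by rw [hx, one_mul]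
      _ = i * (x * y) * i := by noncomm_ring
      _ = i * y * (x * i) := by rw [← h.a_g]; noncomm_ring
      _ = i * y := by rw [hx', mul_one]
  have hiz : z * i = i * (z - y) := by
    have e : x * z = z * x - x * y := by rw [h.b_g]; noncomm_ring
    calc z * i = i * x * (z * i) := by rw [hx, one_mul]
      _ = i * (x * z) * i := by noncomm_ring
      _ = i * z * (x * i) - i * x * (y * i) := by rw [e]; noncomm_ring
      _ = i * (z - y) := by rw [hx', hx, hiy]; noncomm_ring
  have hip : i ^ p * x ^ p = 1 := by
    have hc : Commute i x := by rw [Commute, SemiconjBy, hx, hx']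
    rw [← hc.mul_pow, hx, one_pow]
  refine ⟨?_, ?_, ?_, ?_, ?_, ?_⟩
  · rw [← MulOpposite.op_pow, hi, MulOpposite.op_one]
  · rw [← MulOpposite.op_mul, ← MulOpposite.op_mul]
    congr 1
    rw [neg_mul, mul_assoc, hiy]; noncomm_ring
  · rw [← MulOpposite.op_mul, ← MulOpposite.op_add, ← MulOpposite.op_mul]
    congr 1
    rw [add_mul, neg_mul, neg_mul, mul_assoc, mul_assoc, hiy, hiz]; noncomm_ring
  · rw [← MulOpposite.op_pow, ← MulOpposite.op_pow, ← MulOpposite.op_one, ← MulOpposite.op_sub,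
      ← MulOpposite.op_smul]
    congr 1
    have hc : Commute i y := hiy.symm
    rw [hodd.neg_pow, hc.mul_pow, h.a_pow, mul_smul_comm, mul_sub, mul_one, hip, ← smul_neg,
      neg_sub]
  · rw [← MulOpposite.op_pow, ← MulOpposite.op_pow, ← MulOpposite.op_one, ← MulOpposite.op_sub,
      ← MulOpposite.op_smul]
    congr 1
    rw [hodd.neg_pow, inv_mul_pow_p (natCast_p_eq_zero k p R) hp (v := -((1 / 2 : k) • y)),
      h.b_pow, mul_smul_comm, mul_sub, mul_one, hip, ← smul_neg, neg_sub]
    · simp only [Commute, SemiconjBy, mul_neg, neg_mul, smul_mul_assoc, mul_smul_comm, hiy]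
    · simp only [mul_neg, neg_mul, smul_mul_assoc, mul_smul_comm, h.b_a, smul_add,
        pow_two, smul_neg, neg_add]
      abel
    · rw [mul_neg, two_mul_half h2, hiz, sub_eq_add_neg]
  · rw [← MulOpposite.op_mul, ← MulOpposite.op_mul, ← MulOpposite.op_pow, ← MulOpposite.op_smul,
      ← MulOpposite.op_add]
    congr 1
    have e1 : i * y * (i * z) = i * i * (y * z) := by
      rw [mul_assoc, ← mul_assoc y, hiy]; noncomm_ring
    have e2 : i * z * (i * y) = i * i * (z * y - y * y) := by
      rw [mul_assoc, ← mul_assoc z, hiz]; noncomm_ring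
    have e3 : i * y * (i * y) = i * i * (y * y) := by
      rw [mul_assoc, ← mul_assoc y, hiy]; noncomm_ring
    have e : y * y = (1 / 2 : k) • (y * y) + (1 / 2 : k) • (y * y) := by
      rw [← add_smul, add_halves, one_smul]
    have e4 : z * y - y * y + (1 / 2 : k) • (y * y) = y * z := by
      rw [h.b_a, pow_two]
      nth_rewrite 2 [e]
      abel
    rw [neg_mul_neg, neg_mul_neg, neg_sq, pow_two, e1, e2, e3, ← mul_smul_comm,
      ← mul_add (i * i), e4]

end Hopf

section Antipode

variable {A : Type u} [Ring A] [Bialgebra k A] (S : A →ₐ[k] Aᵐᵒᵖ)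

/-- The linear map underlying an algebra map to the opposite algebra. -/
def unopLin : A →ₗ[k] A := (MulOpposite.opLinearEquiv k).symm.toLinearMap ∘ₗ S.toLinearMap

lemma unopLin_apply (x : A) : unopLin S x = (S x).unop := rfl

lemma unopLin_mul (x y : A) : unopLin S (x * y) = unopLin S y * unopLin S x := by
  simp [unopLin_apply]

/-- Convolution `S * id` evaluated on a tensor. -/
def convL : A ⊗[k] A →ₗ[k] A := LinearMap.mul' k A ∘ₗ (unopLin S).rTensor A

/-- Convolution `id * S` evaluated on a tensor. -/
def convR : A ⊗[k] A →ₗ[k] A := LinearMap.mul' k A ∘ₗ (unopLin S).lTensor A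

lemma convL_tmul (x y : A) : convL S (x ⊗ₜ y) = unopLin S x * y := by simp [convL]

lemma convR_tmul (x y : A) : convR S (x ⊗ₜ y) = x * unopLin S y := by simp [convR]

lemma convL_mul (s t : A ⊗[k] A) {c : k} (hs : convL S s = algebraMap k A c) :
    convL S (s * t) = c • convL S t := by
  induction t using TensorProduct.induction_on with
  | zero => simp
  | add t t' ht ht' => rw [mul_add, map_add, ht, ht', map_add, smul_add]
  | tmul x y =>
    have key : ∀ s : A ⊗[k] A, convL S (s * x ⊗ₜ y) = unopLin S x * convL S s * y := by
      intro s
      induction s using TensorProduct.induction_on with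
      | zero => simp
      | add s s' hs hs' => rw [add_mul, map_add, hs, hs', map_add, mul_add, add_mul]
      | tmul z w =>
        rw [Algebra.TensorProduct.tmul_mul_tmul, convL_tmul, convL_tmul, unopLin_mul]
        noncomm_ring
    rw [key, hs, convL_tmul, ← Algebra.commutes, mul_assoc, ← Algebra.smul_def]

lemma convR_mul (s t : A ⊗[k] A) {c : k} (ht : convR S t = algebraMap k A c) :
    convR S (s * t) = c • convR S s := by
  induction s using TensorProduct.induction_on with
  | zero => simp
  | add s s' hs hs' => rw [add_mul, map_add, hs, hs', map_add, smul_add]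
  | tmul x y =>
    have key : ∀ t : A ⊗[k] A, convR S (x ⊗ₜ y * t) = x * convR S t * unopLin S y := by
      intro t
      induction t using TensorProduct.induction_on with
      | zero => simp
      | add s s' hs hs' => rw [mul_add, map_add, hs, hs', map_add, mul_add, add_mul]
      | tmul z w =>
        rw [Algebra.TensorProduct.tmul_mul_tmul, convR_tmul, convR_tmul, unopLin_mul]
        noncomm_ring
    rw [key, ht, convR_tmul, ← Algebra.commutes, mul_assoc, ← Algebra.smul_def]

/-- The elements on which the antipode axioms hold form a subalgebra. -/
def antipodeSubalgebra : Subalgebra k A where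
  carrier := {x | convL S (Coalgebra.comul x) = algebraMap k A (Coalgebra.counit x) ∧
    convR S (Coalgebra.comul x) = algebraMap k A (Coalgebra.counit x)}
  mul_mem' := by
    rintro x y ⟨hx, hx'⟩ ⟨hy, hy'⟩
    constructor
    · rw [Bialgebra.comul_mul, convL_mul S _ _ hx, hy, Bialgebra.counit_mul, map_mul,
        Algebra.smul_def]
    · rw [Bialgebra.comul_mul, convR_mul S _ _ hy', hx', Bialgebra.counit_mul, map_mul,
        Algebra.smul_def, Algebra.commutes]
  add_mem' := by
    rintro x y ⟨hx, hx'⟩ ⟨hy, hy'⟩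
    constructor
    · rw [map_add, map_add, hx, hy, map_add, map_add]
    · rw [map_add, map_add, hx', hy', map_add, map_add]
  algebraMap_mem' := by
    intro c
    constructor
    · rw [Bialgebra.comul_algebraMap, Bialgebra.counit_algebraMap,
        Algebra.TensorProduct.algebraMap_apply, convL_tmul, unopLin_apply]
      simp
    · rw [Bialgebra.comul_algebraMap, Bialgebra.counit_algebraMap,
        Algebra.TensorProduct.algebraMap_apply, convR_tmul, unopLin_apply]
      simp

end Antipode

lemma subalgebra_eq_top (s : Subalgebra k (LiftAlg k p n lam mu)) (hg : g k p n lam mu ∈ s)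
    (ha : a k p n lam mu ∈ s) (hb : b k p n lam mu ∈ s) (x : LiftAlg k p n lam mu) : x ∈ s := by
  obtain ⟨w, rfl⟩ := mk_surjective x
  induction w using FreeAlgebra.induction with
  | grade0 r => rw [AlgHom.commutes]; exact s.algebraMap_mem r
  | grade1 i =>
    cases i
    · exact hg
    · exact ha
    · exact hb
  | mul x y hx hy => rw [map_mul]; exact s.mul_mem hx hy
  | add x y hx hy => rw [map_add]; exact s.add_mem hx hy

lemma g_mul_pow [NeZero n] : g k p n lam mu * g k p n lam mu ^ (n - 1) = 1 := by
  rw [← pow_succ', Nat.sub_add_cancel (Nat.one_le_iff_ne_zero.2 (NeZero.ne n)), good.g_pow]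

lemma pow_mul_g [NeZero n] : g k p n lam mu ^ (n - 1) * g k p n lam mu = 1 := by
  rw [← pow_succ, Nat.sub_add_cancel (Nat.one_le_iff_ne_zero.2 (NeZero.ne n)), good.g_pow]

section HopfInstance

variable [Fact p.Prime] [CharP k p] [Fact (2 < p)] [NeZero n]

variable (k p n lam mu) in
/-- The antipode as an algebra map to the opposite algebra. -/
def antipodeOp : LiftAlg k p n lam mu →ₐ[k] (LiftAlg k p n lam mu)ᵐᵒᵖ :=
  lift (good_antipode good)

lemma mem_antipodeSubalgebra (x : LiftAlg k p n lam mu) :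
    x ∈ antipodeSubalgebra (antipodeOp k p n lam mu) := by
  apply subalgebra_eq_top
  · constructor
    · rw [comul_g, counit_g, convL_tmul, unopLin_apply, antipodeOp, lift_g]
      simp [pow_mul_g]
    · rw [comul_g, counit_g, convR_tmul, unopLin_apply, antipodeOp, lift_g]
      simp [g_mul_pow]
  · constructor
    · rw [comul_a, counit_a, map_add, convL_tmul, convL_tmul, unopLin_apply, unopLin_apply,
        antipodeOp, lift_g, lift_a]
      simp
    · rw [comul_a, counit_a, map_add, convR_tmul, convR_tmul, unopLin_apply, unopLin_apply,
        antipodeOp, lift_a]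
      simp [← mul_assoc, g_mul_pow]
  · constructor
    · rw [comul_b, counit_b, map_add, convL_tmul, convL_tmul, unopLin_apply, unopLin_apply,
        antipodeOp, lift_g, lift_b]
      simp
    · rw [comul_b, counit_b, map_add, convR_tmul, convR_tmul, unopLin_apply, unopLin_apply,
        antipodeOp, lift_b]
      simp [← mul_assoc, g_mul_pow]

/-- The Hopf algebra `H(λ, μ)`; the values of its structure maps on the generators are the content
of `comul_g`, `comul_a`, `comul_b`, `counit_g`, `counit_a`, `counit_b`, `antipode_g`, `antipode_a`,
`antipode_b`. -/
instance : HopfAlgebra k (LiftAlg k p n lam mu) where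
  antipode := unopLin (antipodeOp k p n lam mu)
  mul_antipode_rTensor_comul := LinearMap.ext fun x => (mem_antipodeSubalgebra x).1
  mul_antipode_lTensor_comul := LinearMap.ext fun x => (mem_antipodeSubalgebra x).2

variable (k p n lam mu) in
/-- The generator `g` as a unit. -/
def gUnit : (LiftAlg k p n lam mu)ˣ :=
  ⟨g k p n lam mu, g k p n lam mu ^ (n - 1), g_mul_pow, pow_mul_g⟩

lemma antipode_g : HopfAlgebra.antipode k (g k p n lam mu) =
    ((gUnit k p n lam mu)⁻¹ : (LiftAlg k p n lam mu)ˣ) :=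
  congrArg MulOpposite.unop (lift_g (good_antipode good))

lemma antipode_a : HopfAlgebra.antipode k (a k p n lam mu) =
    -(((gUnit k p n lam mu)⁻¹ : (LiftAlg k p n lam mu)ˣ) * a k p n lam mu) :=
  congrArg MulOpposite.unop (lift_a (good_antipode good))

lemma antipode_b : HopfAlgebra.antipode k (b k p n lam mu) =
    -(((gUnit k p n lam mu)⁻¹ : (LiftAlg k p n lam mu)ˣ) * b k p n lam mu) :=
  congrArg MulOpposite.unop (lift_b (good_antipode good))

end HopfInstance

variable (k p n lam mu) in
/-- The element `t = (∑ gⁱ) a ^ (p - 1) b ^ (p - 1)`. -/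
def integral : LiftAlg k p n lam mu :=
  (∑ i ∈ Finset.range n, g k p n lam mu ^ i) * a k p n lam mu ^ (p - 1) * b k p n lam mu ^ (p - 1)

end

end LiftAlg

/-! The monomials `g ^ i * a ^ j * b ^ l` with `i < n` and `j, l < p` form a basis. In this basis
every structure is explicit. Let `D` multiply `g ^ i * a ^ j` by `i + j / 2`. The degree `i` makes
sense in `k` because `p ∣ n`, and `a ^ p`, `b ^ p` lie in the span of `1` and `g ^ p`, which have
degree `0`. The relations say that `b x = x b + a D(x)`, where `D` ignores powers of `b`.

The basis property comes from a model of the regular representation on functions of `(l, j, i)`.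
Here `a` and right multiplication by `b` (called `X`) are shifts that wrap around through `λ(1 - g ^
p)` and `μ(1 - g ^ p)`, and `b` acts as `X + a D`. The delicate relation is that for `b ^ p`. Since
`X` commutes with `a D`, it follows from `(a D) ^ p = 0` (`baseA_mul_baseDeg_pow`). The orbit of the
vector standing for `1` separates the monomials, which span by `span_monomials`.

The symmetrizing functional is the coefficient of `g * a ^ (p - 1) * b ^ (p - 1)`. It vanishes on `b
x - x b = a D(x)` because `g * a ^ (p - 2)` has degree `1 + (p - 2) / 2 = 0`
(`topCoord_modelA_modelDeg`). It is also symmetric against `g`, since moving `b ^ l` past `g`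
changes only lower powers of `b`. These two cases suffice, as `a = g⁻¹ b g - b`. It is nondegenerate
because multiplication by suitable powers of the generators moves any coordinate to the top one.

Left integrals are read off in coordinates. The trace property turns them into right integrals.
Finally, `S²` is conjugation by `g⁻¹`, as seen on generators. -/

namespace LiftAlg

noncomputable section

open Module

/-! ### Twisted cyclic shifts -/

section TwistedShift

variable {k : Type*} [Field k] {V : Type*} [AddCommGroup V] [Module k V] {q : ℕ}

variable (q) in
/-- Apply an endomorphism in each component. -/
def mapEnd : End k V →ₐ[k] End k (Fin q → V) where
  toFun f := f.compLeft (Fin q)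
  map_one' := rfl
  map_mul' _ _ := rfl
  map_zero' := rfl
  map_add' _ _ := rfl
  commutes' _ := rfl

@[simp] lemma mapEnd_apply (f : End k V) (v : Fin q → V) (j : Fin q) :
    mapEnd q f v j = f (v j) := rfl

variable (q) in
/-- Multiplication of each component by its index. -/
def indexEnd : End k (Fin q → V) where
  toFun v j := (j : k) • v j
  map_add' v w := by funext j; simp
  map_smul' r v := by funext j; simp [smul_comm r]

@[simp] lemma indexEnd_apply (v : Fin q → V) (j : Fin q) :
    indexEnd (k := k) q v j = ((j : ℕ) : k) • v j := rfl

lemma commute_mapEnd_indexEnd (f : End k V) : Commute (mapEnd q f) (indexEnd q) :=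
  LinearMap.ext fun v => funext fun j => by simp

lemma mapEnd_single (f : End k V) (v : V) (j : Fin q) :
    mapEnd q f (Pi.single j v) = Pi.single j (f v) := by
  funext i
  rw [mapEnd_apply]
  by_cases h : i = j
  · subst h; simp
  · simp [h]

variable [NeZero q]

variable (q) in
/-- The last index. -/
def lastIdx : Fin q := ⟨q - 1, Nat.sub_lt (Nat.pos_of_ne_zero (NeZero.ne q)) one_pos⟩

/-- The shift of a sequence of length `q`, whose `q`-th power is `c` in each component. -/
def twistedShift (c : End k V) : End k (Fin q → V) where
  toFun v j := if (j : ℕ) = 0 then c (v (lastIdx q)) else v ⟨j - 1, (Nat.sub_le _ _).trans_lt j.2⟩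
  map_add' v w := by
    funext j
    by_cases h : (j : ℕ) = 0 <;> simp only [h, if_true, if_false, Pi.add_apply, map_add]
  map_smul' r v := by
    funext j
    by_cases h : (j : ℕ) = 0 <;>
      simp only [h, if_true, if_false, Pi.smul_apply, map_smul, RingHom.id_apply]

lemma twistedShift_zero (c : End k V) (v : Fin q → V) :
    twistedShift c v 0 = c (v (lastIdx q)) := by simp [twistedShift]

lemma twistedShift_succ (c : End k V) (v : Fin q → V) (j : ℕ) (hj : j + 1 < q) :
    twistedShift c v ⟨j + 1, hj⟩ = v ⟨j, by omega⟩ := by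
  simp [twistedShift]

lemma commute_twistedShift {c f : End k V} (h : Commute f c) :
    Commute (mapEnd q f) (twistedShift c) := by
  refine LinearMap.ext fun v => funext fun j => ?_
  obtain ⟨_ | j, hj⟩ := j
  · simpa [twistedShift_zero] using LinearMap.congr_fun h.eq (v (lastIdx q))
  · simp [twistedShift_succ]

lemma twistedShift_pow_apply (c : End k V) (v : Fin q → V) (r j : ℕ) (hj : r + j < q) :
    (twistedShift c ^ r) v ⟨r + j, hj⟩ = v ⟨j, by omega⟩ := by
  induction r with
  | zero => simp
  | succ r ih =>
    have e : (⟨r + 1 + j, hj⟩ : Fin q) = ⟨r + j + 1, by omega⟩ := by ext; simp; omega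
    rw [pow_succ', End.mul_apply, e, twistedShift_succ, ih]

lemma twistedShift_pow_last (c : End k V) (v : Fin q → V) (r : Fin q) :
    (twistedShift c ^ (r : ℕ)) v (lastIdx q) = v ⟨q - 1 - r, by omega⟩ := by
  have e : lastIdx q = ⟨r + (q - 1 - r), by omega⟩ := by ext; simp [lastIdx]; omega
  rw [e, twistedShift_pow_apply]

/-- In `q` consecutive steps each component passes the wrap-around exactly once. -/
lemma twistedShift_pow_self (c : End k V) :
    (twistedShift c : End k (Fin q → V)) ^ q = mapEnd q c := by
  refine LinearMap.ext fun v => funext fun j => ?_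
  -- Read from component `j`: `j` plain steps back to `0`, one wrapping step to the last component,
  -- then `q - 1 - j` plain steps back to `j`.
  have hc : (twistedShift c : End k (Fin q → V)) ^ q = twistedShift c ^ (j : ℕ) *
      (twistedShift c * twistedShift c ^ (q - 1 - j)) := by
    rw [← pow_succ', ← pow_add]; congr 1; omega
  have e : (⟨(j : ℕ) + 0, by omega⟩ : Fin q) = j := rfl
  have h := twistedShift_pow_apply (q := q) c
    ((twistedShift c * twistedShift c ^ (q - 1 - (j : ℕ)) : End k (Fin q → V)) v) j 0
    (by omega)
  rw [hc, End.mul_apply, mapEnd_apply]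
  rw [e] at h
  rw [h, End.mul_apply, Fin.mk_zero', twistedShift_zero]
  have h2 := twistedShift_pow_last c v ⟨q - 1 - j, by omega⟩
  simp only at h2
  rw [h2]
  congr 2
  ext
  simp
  omega

/-- The shift has degree one, even at the wrap from `q - 1` to `0`, since indices only count modulo
the characteristic `q`. -/
lemma indexEnd_mul_twistedShift [CharP k q] (c : End k V) :
    indexEnd q * twistedShift c = twistedShift c * indexEnd q + twistedShift c := by
  refine LinearMap.ext fun v => funext fun j => ?_
  obtain ⟨_ | j, hj⟩ := j
  · have e : ((lastIdx q : ℕ) : k) = -1 := by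
      have : ((lastIdx q : ℕ) : k) + 1 = ((lastIdx q + 1 : ℕ) : k) := by push_cast; rfl
      rw [eq_neg_iff_add_eq_zero, this, lastIdx]
      simp only
      rw [Nat.sub_add_cancel (NeZero.one_le), CharP.cast_eq_zero]
    simp [twistedShift_zero, e]
  · simp [twistedShift_succ, add_smul]

lemma twistedShift_single (c : End k V) (v : V) (j : ℕ) (hj : j + 1 < q) :
    twistedShift c (Pi.single ⟨j, by omega⟩ v) = Pi.single (⟨j + 1, hj⟩ : Fin q) v := by
  funext i
  obtain ⟨_ | i, hi⟩ := i
  · rw [Fin.mk_zero', twistedShift_zero, Pi.single_eq_of_ne, Pi.single_eq_of_ne, map_zero]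
    · simp
    · intro h; have := congrArg Fin.val h; simp only [lastIdx] at this; omega
  · rw [twistedShift_succ]
    simp [Pi.single_apply]

lemma twistedShift_pow_single (c : End k V) (v : V) (j : Fin q) :
    (twistedShift c ^ (j : ℕ)) (Pi.single (0 : Fin q) v) = Pi.single j v := by
  obtain ⟨j, hj⟩ := j
  simp only
  induction j with
  | zero => rfl
  | succ j ih => rw [pow_succ', End.mul_apply, ih (by omega), twistedShift_single]

/-- A power of the sum of the twisted shift and a componentwise map moves a vector concentrated
in degree `0` up to the exponent, with the same leading term as the shift. -/
lemma add_pow_apply_of_le (c f : End k V) (w : Fin q → V)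
    (hw : ∀ j : Fin q, (j : ℕ) ≠ 0 → w j = 0) (l : ℕ) (j : Fin q) (hj : l ≤ j) :
    (((twistedShift c + mapEnd q f : End k (Fin q → V)) ^ l) w) j = if l = j then w 0 else 0 := by
  induction l generalizing j with
  | zero =>
    split_ifs with h
    · have : j = 0 := Fin.ext h.symm
      simp [this]
    · simpa using hw j fun h' => h h'.symm
  | succ l ih =>
    obtain ⟨_ | j, hj'⟩ := j
    · simp at hj
    · simp only [Nat.add_le_add_iff_right] at hj
      -- The component `j + 1` is not `0`, so the shift never uses `c` here; the componentwise term
      -- vanishes by induction because `l < j + 1`.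
      rw [pow_succ', End.mul_apply, LinearMap.add_apply, Pi.add_apply, twistedShift_succ,
        mapEnd_apply, ih ⟨j, _⟩ hj, ih ⟨j + 1, _⟩ (by simp; omega)]
      have : l ≠ j + 1 := by omega
      simp [this]

/-- This turns annihilation by `a` or by `X` into a condition on coordinates, used both to verify
that `t` is an integral and to show that there are no others. -/
lemma twistedShift_eq_zero_iff (c : End k V) (v : Fin q → V) :
    twistedShift c v = 0 ↔ (∀ j, j ≠ lastIdx q → v j = 0) ∧ c (v (lastIdx q)) = 0 := by
  constructor
  · intro h
    refine ⟨fun j hj => ?_, ?_⟩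
    · have hj' : (j : ℕ) + 1 < q := by
        have : (j : ℕ) ≠ q - 1 := fun h' => hj (Fin.ext h')
        omega
      rw [← twistedShift_succ c v j hj', h]; rfl
    · rw [← twistedShift_zero, h]; rfl
  · rintro ⟨h1, h2⟩
    funext j
    obtain ⟨_ | j, hj⟩ := j
    · rw [Fin.mk_zero', twistedShift_zero, h2]; rfl
    · rw [twistedShift_succ]
      refine h1 _ fun h => ?_
      have := congrArg Fin.val h
      simp only [lastIdx] at this
      omega

end TwistedShift

/-! ### Powers of a product with a graded commutation rule -/

/-- `A` raises eigenvalues of `D` by `s`, so the successive factors `D` contribute `e`, `e + s`, `e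
+ 2 s`, and so on. -/
lemma mul_pow_apply_of_eigenvector {k V : Type*} [Field k] [AddCommGroup V] [Module k V]
    {A D : End k V} {s : k} (h : D * A = A * D + s • A) {e : k} {v : V} (hv : D v = e • v) (m : ℕ) :
    ((A * D) ^ m) v = (∏ r ∈ Finset.range m, (e + r * s)) • (A ^ m) v := by
  have hD : ∀ r : ℕ, D ((A ^ r) v) = (e + r * s) • (A ^ r) v := by
    intro r
    induction r with
    | zero => simpa using hv
    | succ r ih =>
      have h1 := LinearMap.congr_fun h ((A ^ r) v)
      simp only [End.mul_apply, LinearMap.add_apply, LinearMap.smul_apply, ih, map_smul] at h1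
      rw [pow_succ', End.mul_apply, h1, ← add_smul]
      push_cast
      ring_nf
  induction m with
  | zero => simp
  | succ m ih =>
    rw [pow_succ', End.mul_apply, ih, map_smul, End.mul_apply, hD, map_smul, smul_smul,
      Finset.prod_range_succ, pow_succ', End.mul_apply]

/-! ### The model of the regular representation -/

section GroupPart

variable {k : Type u} [Field k] {p n : ℕ}

variable (k n) in
/-- The cyclic shift of functions on `ZMod n`. -/
def gShift : End k (ZMod n → k) := LinearMap.funLeft k k fun i => i - 1

@[simp] lemma gShift_apply (v : ZMod n → k) (i : ZMod n) : gShift k n v i = v (i - 1) := rfl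

lemma gShift_pow_apply (m : ℕ) (v : ZMod n → k) (i : ZMod n) :
    (gShift k n ^ m) v i = v (i - m) := by
  induction m generalizing i with
  | zero => simp
  | succ m ih =>
    rw [pow_succ', End.mul_apply, gShift_apply, ih]
    congr 1
    push_cast
    ring

lemma gShift_pow_self : gShift k n ^ n = 1 :=
  LinearMap.ext fun v => funext fun i => by simp [gShift_pow_apply]

variable [CharP k p]

variable (k) in
/-- The grading of functions on `ZMod n` by the residue of the index modulo `p`. -/
def gDeg (hpn : p ∣ n) : End k (ZMod n → k) where
  toFun v i := ZMod.castHom hpn k i * v i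
  map_add' v w := by funext i; simp [mul_add]
  map_smul' r v := by funext i; simp [mul_left_comm]

@[simp] lemma gDeg_apply (hpn : p ∣ n) (v : ZMod n → k) (i : ZMod n) :
    gDeg k hpn v i = ZMod.castHom hpn k i * v i := rfl

lemma gDeg_mul_gShift (hpn : p ∣ n) :
    gDeg k hpn * gShift k n = gShift k n * gDeg k hpn + gShift k n := by
  refine LinearMap.ext fun v => funext fun i => ?_
  simp only [End.mul_apply, gDeg_apply, gShift_apply, LinearMap.add_apply, Pi.add_apply, map_sub,
    map_one]
  ring

/-- `g ^ p` has degree `p = 0`, so the wrap-around terms of both shifts preserve the degree. -/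
lemma commute_gDeg (hpn : p ∣ n) (c : k) : Commute (gDeg k hpn) (c • (1 - gShift k n ^ p)) := by
  refine LinearMap.ext fun v => funext fun i => ?_
  simp only [End.mul_apply, gDeg_apply, LinearMap.smul_apply, LinearMap.sub_apply, End.one_apply,
    Pi.smul_apply, Pi.sub_apply, gShift_pow_apply, map_sub, map_natCast, CharP.cast_eq_zero,
    smul_eq_mul]
  ring

end GroupPart

/-! ### The subalgebra generated by `g` and `a` -/

section Model

variable {k : Type u} [Field k] {p n : ℕ} {lam mu : k}

variable (k p n) in
/-- The action of `g` on the subalgebra generated by `g` and `a`. -/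
def baseG : End k (Fin p → ZMod n → k) := mapEnd p (gShift k n)

variable [Fact p.Prime]

variable (p n lam) in
/-- The action of `a` on the subalgebra generated by `g` and `a`. -/
def baseA : End k (Fin p → ZMod n → k) := twistedShift (lam • (1 - gShift k n ^ p))

lemma baseA_pow : baseA p n lam ^ p = lam • (1 - baseG k p n ^ p) := by
  rw [baseA, twistedShift_pow_self, baseG, map_smul, map_sub, map_one, map_pow]

lemma commute_baseG_baseA : Commute (baseG k p n) (baseA p n lam) :=
  commute_twistedShift
    (((Commute.one_right _).sub_right ((Commute.refl _).pow_right p)).smul_right lam)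

/-! ### The degree derivation and the nilpotency of `a D` -/

section Derivation

variable [CharP k p]

variable (k) in
/-- The grading for which the commutator with `b` is `a` times the degree. -/
def baseDeg (hpn : p ∣ n) : End k (Fin p → ZMod n → k) :=
  mapEnd p (gDeg k hpn) + (1 / 2 : k) • indexEnd p

omit [Fact p.Prime] in
lemma baseDeg_mul_baseG (hpn : p ∣ n) :
    baseDeg k hpn * baseG k p n = baseG k p n * baseDeg k hpn + baseG k p n := by
  rw [baseDeg, baseG, add_mul, mul_add, ← map_mul, gDeg_mul_gShift, map_add, map_mul,
    smul_mul_assoc, mul_smul_comm, (commute_mapEnd_indexEnd _).eq]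
  abel

lemma baseDeg_mul_baseA (hpn : p ∣ n) :
    baseDeg k hpn * baseA p n lam = baseA p n lam * baseDeg k hpn + (1 / 2 : k) • baseA p n lam := by
  rw [baseDeg, baseA, add_mul, mul_add, smul_mul_assoc, mul_smul_comm, indexEnd_mul_twistedShift,
    (commute_twistedShift (commute_gDeg hpn lam)).eq, smul_add]
  abel

omit [Fact p.Prime] in
lemma baseDeg_single (hpn : p ∣ n) (j : Fin p) (i : ZMod n) :
    baseDeg k hpn (Pi.single j (Pi.single i 1)) =
      (ZMod.castHom hpn k i + (1 / 2 : k) * (j : ℕ)) •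
        (Pi.single j (Pi.single i 1) : Fin p → ZMod n → k) := by
  funext j' i'
  by_cases hj : j' = j
  · subst hj
    by_cases hi : i' = i
    · subst hi; simp [baseDeg]
    · simp [baseDeg, hi]
  · simp [baseDeg, hj]

variable [Fact (2 < p)] [NeZero n]

/-- All degrees lie in the prime field, which `p` successive steps of size `1 / 2` exhaust. -/
lemma exists_add_half_mul_eq_zero (hpn : p ∣ n) (i : ZMod n) (j : ℕ) :
    ∃ r < p, ZMod.castHom hpn k i + (1 / 2 : k) * (j : ℕ) + r * (1 / 2 : k) = 0 := by
  have h2 : (2 : k) ≠ 0 := two_ne_of_char k p Fact.out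
  have hp : 0 < p := (Fact.out : p.Prime).pos
  -- The equation asks for `r ≡ -(2 i + j)` modulo `p`; multiplication by `p - 1` expresses the sign
  -- in `ℕ`.
  refine ⟨((2 * i.val + j) * (p - 1)) % p, Nat.mod_lt _ hp, ?_⟩
  have hi : ZMod.castHom hpn k i = (i.val : k) := by
    conv_lhs => rw [← ZMod.natCast_zmod_val i]
    rw [map_natCast]
  have h : ((((2 * i.val + j) * (p - 1)) % p : ℕ) : k) = -((2 * i.val + j : ℕ) : k) := by
    rw [eq_neg_iff_add_eq_zero, ← Nat.cast_add, CharP.cast_eq_zero_iff k p, Nat.dvd_iff_mod_eq_zero,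
      Nat.mod_add_mod]
    have : (2 * i.val + j) * (p - 1) + (2 * i.val + j) = (2 * i.val + j) * p := by
      rw [← Nat.mul_succ, Nat.succ_eq_add_one, Nat.sub_add_cancel hp]
    rw [this, Nat.mul_mod_left]
  rw [hi, h]
  push_cast
  field_simp
  ring

/-- On a monomial, one of the `p` successive degrees is zero. -/
lemma baseA_mul_baseDeg_pow (hpn : p ∣ n) : (baseA p n lam * baseDeg k hpn) ^ p = 0 := by
  refine LinearMap.pi_ext' fun j => LinearMap.pi_ext' fun i => LinearMap.ext_ring ?_
  simp only [LinearMap.comp_apply, LinearMap.coe_single, LinearMap.zero_apply]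
  rw [mul_pow_apply_of_eigenvector (baseDeg_mul_baseA hpn) (baseDeg_single hpn j i)]
  obtain ⟨r, hr, h⟩ := exists_add_half_mul_eq_zero (k := k) hpn i j
  rw [Finset.prod_eq_zero (Finset.mem_range.2 hr) h, zero_smul]

end Derivation

/-! ### Adjoining `b`: the full model and its relations -/

variable (k p n) in
/-- The action of `g` on the model. -/
def modelG : End k (Fin p → Fin p → ZMod n → k) := mapEnd p (baseG k p n)

variable (p n lam) in
/-- The action of `a` on the model. -/
def modelA : End k (Fin p → Fin p → ZMod n → k) := mapEnd p (baseA p n lam)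

variable (p n mu) in
/-- The right multiplication by `b` on the model. -/
def modelX : End k (Fin p → Fin p → ZMod n → k) := twistedShift (mu • (1 - baseG k p n ^ p))

lemma modelX_pow : modelX p n mu ^ p = mu • (1 - modelG k p n ^ p) := by
  rw [modelX, twistedShift_pow_self, modelG, map_smul, map_sub, map_one, map_pow]

lemma commute_modelX_of_commute {f : End k (Fin p → ZMod n → k)}
    (h : Commute f (mu • (1 - baseG k p n ^ p))) : Commute (mapEnd p f) (modelX p n mu) :=
  commute_twistedShift h

lemma commute_modelG_modelX : Commute (modelG k p n) (modelX p n mu) :=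
  commute_modelX_of_commute
    (((Commute.one_right _).sub_right ((Commute.refl _).pow_right p)).smul_right mu)

lemma commute_modelA_modelX : Commute (modelA p n lam) (modelX p n mu) :=
  commute_modelX_of_commute
    (((Commute.one_right _).sub_right (commute_baseG_baseA.symm.pow_right p)).smul_right mu)

variable [CharP k p]

variable (k) in
/-- The grading of the model. -/
def modelDeg (hpn : p ∣ n) : End k (Fin p → Fin p → ZMod n → k) := mapEnd p (baseDeg k hpn)

lemma modelDeg_mul_modelA (hpn : p ∣ n) : modelDeg k hpn * modelA p n lam =
    modelA p n lam * modelDeg k hpn + (1 / 2 : k) • modelA p n lam := by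
  rw [modelDeg, modelA, ← map_mul, baseDeg_mul_baseA, map_add, map_mul, map_smul]

/-- The degree ignores the exponent of `b`, and the wrap-around `μ(1 - g ^ p)` has degree `0`. -/
lemma commute_modelDeg_modelX (hpn : p ∣ n) : Commute (modelDeg k hpn) (modelX p n mu) := by
  refine commute_modelX_of_commute ?_
  have h : mu • (1 - baseG k p n ^ p) = mapEnd p (mu • (1 - gShift k n ^ p)) := by
    rw [map_smul, map_sub, map_one, map_pow, baseG]
  rw [h]
  exact ((commute_gDeg hpn mu).map (mapEnd p)).add_left
    ((commute_mapEnd_indexEnd _).symm.smul_left _)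

variable (lam mu) in
/-- The action of `b` on the model. -/
def modelB (hpn : p ∣ n) : End k (Fin p → Fin p → ZMod n → k) :=
  modelX p n mu + modelA p n lam * modelDeg k hpn

variable [Fact (2 < p)] [NeZero n]

lemma good_model (hpn : p ∣ n) :
    Good p n lam mu (modelG k p n) (modelA p n lam) (modelB lam mu hpn) where
  g_pow := by rw [modelG, baseG, ← map_pow, ← map_pow, gShift_pow_self, map_one, map_one]
  a_g := (commute_baseG_baseA.map (mapEnd p)).eq.symm
  b_g := by
    have h : modelDeg k hpn * modelG k p n =
        modelG k p n * modelDeg k hpn + modelG k p n := by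
      rw [modelDeg, modelG, ← map_mul, baseDeg_mul_baseG, map_add, map_mul]
    have h' : modelG k p n * modelA p n lam = modelA p n lam * modelG k p n :=
      (commute_baseG_baseA.map (mapEnd p)).eq
    rw [modelB, add_mul, mul_assoc, h, ← commute_modelG_modelX.eq, mul_add, ← mul_assoc, ← h',
      mul_add, mul_add, mul_assoc]
    abel
  a_pow := by rw [modelA, modelG, ← map_pow, baseA_pow, map_smul, map_sub, map_one, map_pow]
  b_pow := by
    -- The two summands of `b` commute, so in characteristic `p` the power is `X ^ p + (a D) ^ p`,
    -- and the second term is zero.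
    have hc : Commute (modelX p n mu) (modelA p n lam * modelDeg k hpn) :=
      commute_modelA_modelX.symm.mul_right (commute_modelDeg_modelX hpn).symm
    obtain ⟨r, hr⟩ := hc.exists_add_pow_prime_eq (Fact.out : p.Prime)
    rw [modelB, hr, natCast_p_eq_zero k p, modelX_pow, modelA, modelDeg, ← map_mul, ← map_pow,
      baseA_mul_baseDeg_pow, map_zero, zero_mul, zero_mul, zero_mul, add_zero, add_zero]
  b_a := by
    rw [modelB, add_mul, mul_assoc, modelDeg_mul_modelA, ← commute_modelA_modelX.eq, mul_add,
      mul_add, mul_smul_comm, pow_two]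
    abel

end Model

/-! ### Spanning by monomials -/

section Spanning

variable {k : Type u} [Field k] {p n : ℕ} {lam mu : k}

lemma Good.commute_pow_a_pow_g {R : Type*} [Ring R] [Algebra k R] {x y z : R}
    (h : Good p n lam mu x y z) (i j : ℕ) : y ^ j * x ^ i = x ^ i * y ^ j :=
  ((show Commute y x from h.a_g).pow_pow j i).eq

lemma Good.b_mul_g_pow {R : Type*} [Ring R] [Algebra k R] {x y z : R}
    (h : Good p n lam mu x y z) (i : ℕ) : z * x ^ i = x ^ i * z + (i : k) • (x ^ i * y) := by
  induction i with
  | zero => simp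
  | succ i ih =>
    rw [pow_succ, ← mul_assoc, ih, add_mul, mul_assoc (x ^ i) z, h.b_g, smul_mul_assoc,
      mul_assoc (x ^ i) y, h.a_g, ← mul_assoc, ← mul_assoc, mul_add]
    push_cast
    module

lemma Good.b_mul_a_pow {R : Type*} [Ring R] [Algebra k R] {x y z : R}
    (h : Good p n lam mu x y z) (j : ℕ) :
    z * y ^ j = y ^ j * z + (j * (1 / 2 : k)) • y ^ (j + 1) := by
  induction j with
  | zero => simp
  | succ j ih =>
    rw [pow_succ, ← mul_assoc, ih, add_mul, mul_assoc (y ^ j) z, h.b_a, smul_mul_assoc,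
      mul_add, mul_smul_comm, ← pow_add, ← mul_assoc, ← pow_succ, ← pow_succ]
    push_cast
    module

variable (k p n lam mu) in
/-- The monomials `g ^ i * a ^ j * b ^ l` with `j, l < p`. -/
def monomials : Set (LiftAlg k p n lam mu) :=
  {x | ∃ i j l : ℕ, j < p ∧ l < p ∧ x = g k p n lam mu ^ i * a k p n lam mu ^ j *
    b k p n lam mu ^ l}

/-- Multiplication by one generator raises an exponent below `p` to at most `p`, so `j = p` is the
only overflow to reduce. -/
lemma monomial_mem_span_of_le_left (hp : 0 < p) (i : ℕ) {j l : ℕ} (hj : j ≤ p) (hl : l < p) :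
    g k p n lam mu ^ i * a k p n lam mu ^ j * b k p n lam mu ^ l ∈
      Submodule.span k (monomials k p n lam mu) := by
  rcases hj.lt_or_eq with hj | rfl
  · exact Submodule.subset_span ⟨i, j, l, hj, hl, rfl⟩
  · rw [good.a_pow, mul_smul_comm, smul_mul_assoc, mul_sub, mul_one, ← pow_add, sub_mul]
    refine Submodule.smul_mem _ _ (Submodule.sub_mem _ ?_ ?_)
    · exact Submodule.subset_span ⟨i, 0, l, hp, hl, by simp⟩
    · exact Submodule.subset_span ⟨i + j, 0, l, hp, hl, by simp⟩

lemma monomial_mem_span_of_le_right (hp : 0 < p) (i : ℕ) {j l : ℕ} (hj : j < p) (hl : l ≤ p) :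
    g k p n lam mu ^ i * a k p n lam mu ^ j * b k p n lam mu ^ l ∈
      Submodule.span k (monomials k p n lam mu) := by
  rcases hl.lt_or_eq with hl | rfl
  · exact Submodule.subset_span ⟨i, j, l, hj, hl, rfl⟩
  · rw [good.b_pow, mul_smul_comm, mul_sub, mul_one, mul_assoc, good.commute_pow_a_pow_g,
      ← mul_assoc, ← pow_add]
    refine Submodule.smul_mem _ _ (Submodule.sub_mem _ ?_ ?_)
    · exact Submodule.subset_span ⟨i, j, 0, hj, hp, by simp⟩
    · exact Submodule.subset_span ⟨i + l, j, 0, hj, hp, by simp⟩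

/-- The elements which map a submodule to itself by left multiplication. -/
def leftStabilizer {A : Type*} [Ring A] [Algebra k A] (U : Submodule k A) : Subalgebra k A where
  carrier := {h | ∀ x ∈ U, h * x ∈ U}
  mul_mem' := by
    intro h h' hh hh' x hx
    rw [mul_assoc]
    exact hh _ (hh' x hx)
  add_mem' := by
    intro h h' hh hh' x hx
    rw [add_mul]
    exact U.add_mem (hh x hx) (hh' x hx)
  algebraMap_mem' := by
    intro c x hx
    rw [← Algebra.smul_def]
    exact U.smul_mem c hx

lemma mem_leftStabilizer_span {A : Type*} [Ring A] [Algebra k A] {s : Set A} {h : A}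
    (hs : ∀ x ∈ s, h * x ∈ Submodule.span k s) : h ∈ leftStabilizer (Submodule.span k s) := by
  intro x hx
  induction hx using Submodule.span_induction with
  | mem x hx => exact hs x hx
  | zero => rw [mul_zero]; exact Submodule.zero_mem _
  | add x y _ _ hx hy => rw [mul_add]; exact Submodule.add_mem _ hx hy
  | smul c x _ hx => rw [mul_smul_comm]; exact Submodule.smul_mem _ _ hx

/-- The span contains `1` and is stable under left multiplication by the generators, hence by the
whole algebra. -/
lemma span_monomials (hp : 0 < p) : Submodule.span k (monomials k p n lam mu) = ⊤ := by
  refine Submodule.eq_top_iff'.2 fun x => ?_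
  have h1 : (1 : LiftAlg k p n lam mu) ∈ Submodule.span k (monomials k p n lam mu) :=
    Submodule.subset_span ⟨0, 0, 0, hp, hp, by simp⟩
  suffices h : x ∈ leftStabilizer (Submodule.span k (monomials k p n lam mu)) by
    simpa using h 1 h1
  refine subalgebra_eq_top _ ?_ ?_ ?_ x
  all_goals
    refine mem_leftStabilizer_span ?_
    rintro _ ⟨i, j, l, hj, hl, rfl⟩
  · exact Submodule.subset_span ⟨i + 1, j, l, hj, hl, by rw [pow_succ', mul_assoc, mul_assoc,
      mul_assoc]⟩
  · have e : a k p n lam mu * (g k p n lam mu ^ i * a k p n lam mu ^ j * b k p n lam mu ^ l) =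
        g k p n lam mu ^ i * a k p n lam mu ^ (j + 1) * b k p n lam mu ^ l := by
      have h := good.commute_pow_a_pow_g (k := k) (p := p) (n := n) (lam := lam) (mu := mu) i 1
      rw [pow_one] at h
      rw [← mul_assoc, ← mul_assoc, h, pow_succ', ← mul_assoc]
    rw [e]
    exact monomial_mem_span_of_le_left hp i hj hl
  · have e : b k p n lam mu * (g k p n lam mu ^ i * a k p n lam mu ^ j * b k p n lam mu ^ l) =
        g k p n lam mu ^ i * a k p n lam mu ^ j * b k p n lam mu ^ (l + 1) +
          (j * (1 / 2 : k) + i) •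
            (g k p n lam mu ^ i * a k p n lam mu ^ (j + 1) * b k p n lam mu ^ l) := by
      rw [← mul_assoc, ← mul_assoc, good.b_mul_g_pow, add_mul, mul_assoc (g k p n lam mu ^ i),
        good.b_mul_a_pow, smul_mul_assoc, mul_assoc _ (a k p n lam mu), ← pow_succ', mul_add,
        mul_smul_comm, pow_succ' (b k p n lam mu), add_mul, add_mul]
      simp only [mul_assoc, smul_mul_assoc, add_smul]
      abel
    rw [e]
    exact Submodule.add_mem _ (monomial_mem_span_of_le_right hp i hj hl)
      (Submodule.smul_mem _ _ (monomial_mem_span_of_le_left hp i hj hl))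

end Spanning

/-! ### The regular representation -/

section Orbit

variable {k : Type u} [Field k] {p n : ℕ} {lam mu : k}

lemma gShift_pow_single (i : ℕ) (c : k) :
    (gShift k n ^ i) (Pi.single 0 c) = Pi.single (i : ZMod n) c := by
  funext i'
  rw [gShift_pow_apply]
  simp [Pi.single_apply, sub_eq_zero]

variable [Fact p.Prime]

variable (k p n) in
/-- The cyclic vector of the model. -/
def cyclicVector : Fin p → Fin p → ZMod n → k := Pi.single 0 (Pi.single 0 (Pi.single 0 1))

lemma model_monomial_apply (i : ℕ) (j l : Fin p) :
    (modelG k p n ^ i) ((modelA p n lam ^ (j : ℕ)) ((modelX p n mu ^ (l : ℕ))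
      (cyclicVector k p n))) = Pi.single l (Pi.single j (Pi.single (i : ZMod n) 1)) := by
  rw [cyclicVector, modelX, twistedShift_pow_single, modelA, modelG, ← map_pow, ← map_pow,
    mapEnd_single, mapEnd_single, baseA, baseG, twistedShift_pow_single, ← map_pow, mapEnd_single,
    gShift_pow_single]

variable [CharP k p]

lemma modelDeg_cyclicVector (hpn : p ∣ n) : modelDeg k hpn (cyclicVector k p n) = 0 := by
  rw [modelDeg, cyclicVector, mapEnd_single, baseDeg_single]
  simp

/-- The cyclic vector stands for `1` and has degree `0`; `X` preserves degrees, so the term `a D`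
never contributes. -/
lemma modelB_pow_cyclicVector (hpn : p ∣ n) (l : ℕ) :
    (modelB lam mu hpn ^ l) (cyclicVector k p n) = (modelX p n mu ^ l) (cyclicVector k p n) := by
  induction l with
  | zero => simp
  | succ l ih =>
    have h : modelDeg k hpn ((modelX p n mu ^ l) (cyclicVector k p n)) = 0 := by
      rw [← End.mul_apply, ((commute_modelDeg_modelX hpn).pow_right l).eq, End.mul_apply,
        modelDeg_cyclicVector, map_zero]
    rw [pow_succ', End.mul_apply, ih, modelB, LinearMap.add_apply, End.mul_apply, h, map_zero,
      add_zero, pow_succ', End.mul_apply]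

variable [Fact (2 < p)] [NeZero n]

variable (lam mu) in
/-- The representation of `H(λ, μ)` on the model. -/
def rep (hpn : p ∣ n) : LiftAlg k p n lam mu →ₐ[k] End k (Fin p → Fin p → ZMod n → k) :=
  lift (good_model hpn)

variable (lam mu) in
/-- The orbit map of the cyclic vector. -/
def orbit (hpn : p ∣ n) : LiftAlg k p n lam mu →ₗ[k] (Fin p → Fin p → ZMod n → k) :=
  LinearMap.applyₗ (cyclicVector k p n) ∘ₗ (rep lam mu hpn).toLinearMap

lemma orbit_apply (hpn : p ∣ n) (x : LiftAlg k p n lam mu) :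
    orbit lam mu hpn x = rep lam mu hpn x (cyclicVector k p n) := rfl

lemma orbit_mul (hpn : p ∣ n) (x y : LiftAlg k p n lam mu) :
    orbit lam mu hpn (x * y) = rep lam mu hpn x (orbit lam mu hpn y) := by
  rw [orbit_apply, orbit_apply, map_mul, End.mul_apply]

@[simp] lemma rep_g (hpn : p ∣ n) : rep lam mu hpn (g k p n lam mu) = modelG k p n := lift_g _
@[simp] lemma rep_a (hpn : p ∣ n) : rep lam mu hpn (a k p n lam mu) = modelA p n lam := lift_a _
@[simp] lemma rep_b (hpn : p ∣ n) : rep lam mu hpn (b k p n lam mu) = modelB lam mu hpn := lift_b _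

lemma orbit_monomial (hpn : p ∣ n) (i : ℕ) (j l : Fin p) :
    orbit lam mu hpn (g k p n lam mu ^ i * a k p n lam mu ^ (j : ℕ) * b k p n lam mu ^ (l : ℕ)) =
      Pi.single l (Pi.single j (Pi.single (i : ZMod n) 1)) := by
  rw [orbit_apply, map_mul, map_mul, map_pow, map_pow, map_pow, rep_g, rep_a, rep_b, End.mul_apply,
    modelB_pow_cyclicVector, End.mul_apply, model_monomial_apply]

variable (k p n lam mu) in
/-- The linear map from the model to `H(λ, μ)` given by the monomials. -/
def ofModel : (Fin p → Fin p → ZMod n → k) →ₗ[k] LiftAlg k p n lam mu :=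
  LinearMap.lsum k (fun _ => Fin p → ZMod n → k) k fun l =>
    LinearMap.lsum k (fun _ => ZMod n → k) k fun j =>
      LinearMap.lsum k (fun _ => k) k fun i =>
        LinearMap.toSpanSingleton k _
          (g k p n lam mu ^ i.val * a k p n lam mu ^ (j : ℕ) * b k p n lam mu ^ (l : ℕ))

omit [Fact p.Prime] [CharP k p] [Fact (2 < p)] in
lemma ofModel_single (l j : Fin p) (i : ZMod n) :
    ofModel k p n lam mu (Pi.single l (Pi.single j (Pi.single i 1))) =
      g k p n lam mu ^ i.val * a k p n lam mu ^ (j : ℕ) * b k p n lam mu ^ (l : ℕ) := by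
  rw [ofModel, LinearMap.lsum_piSingle, LinearMap.lsum_piSingle, LinearMap.lsum_piSingle,
    LinearMap.toSpanSingleton_apply, one_smul]

/-- Since `ofModel` is defined on the model, the identity need only be checked on the spanning
monomials, and their independence is not needed beforehand. -/
lemma ofModel_orbit (hpn : p ∣ n) (x : LiftAlg k p n lam mu) :
    ofModel k p n lam mu (orbit lam mu hpn x) = x := by
  have h : ofModel k p n lam mu ∘ₗ orbit lam mu hpn = LinearMap.id := by
    refine LinearMap.ext_on (span_monomials (Fact.out : p.Prime).pos) ?_
    rintro _ ⟨i, j, l, hj, hl, rfl⟩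
    have h := orbit_monomial (lam := lam) (mu := mu) hpn i ⟨j, hj⟩ ⟨l, hl⟩
    simp only at h
    -- The exponent of `g` in `monomials` is unbounded and returns reduced modulo `n`.
    rw [LinearMap.comp_apply, h, ofModel_single, LinearMap.id_apply, ZMod.val_natCast,
      ← pow_eq_pow_mod _ good.g_pow]
  exact LinearMap.congr_fun h x

lemma orbit_injective (hpn : p ∣ n) : Function.Injective (orbit lam mu hpn) :=
  Function.LeftInverse.injective (ofModel_orbit hpn)

lemma finiteDimensional (hpn : p ∣ n) : FiniteDimensional k (LiftAlg k p n lam mu) :=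
  Module.Finite.of_injective _ (orbit_injective hpn)

end Orbit

variable {k : Type u} [Field k] {p n : ℕ} {lam mu : k} [Fact p.Prime]

/-! ### The symmetrizing form -/

variable (k p n) in
/-- The coordinate of the monomial `g * a ^ (p - 1) * b ^ (p - 1)`. -/
def topCoord : (Fin p → Fin p → ZMod n → k) →ₗ[k] k :=
  LinearMap.proj 1 ∘ₗ LinearMap.proj (lastIdx p) ∘ₗ LinearMap.proj (lastIdx p)

lemma topCoord_apply (v : Fin p → Fin p → ZMod n → k) :
    topCoord k p n v = v (lastIdx p) (lastIdx p) 1 := rfl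

/-- Fewer than `p` shifts, read at the last index, never wrap, so `λ` and `μ` do not enter and every
coordinate can be reached. -/
lemma topCoord_monomial_apply (v : Fin p → Fin p → ZMod n → k) (i : ℕ) (j l : Fin p) :
    topCoord k p n ((modelG k p n ^ i) ((modelA p n lam ^ (j : ℕ)) ((modelX p n mu ^ (l : ℕ)) v))) =
      v ⟨p - 1 - l, by omega⟩ ⟨p - 1 - j, by omega⟩ (1 - i) := by
  rw [topCoord_apply, modelG, modelA, modelX, baseG, ← map_pow, ← map_pow, ← map_pow, mapEnd_apply,
    mapEnd_apply, mapEnd_apply, twistedShift_pow_last, baseA, twistedShift_pow_last,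
    gShift_pow_apply]

variable [CharP k p]

/-- The value is a coefficient at `g * a ^ (p - 2) * b ^ (p - 1)` times the degree `1 + (p - 2) / 2
= 0`. This is why the functional reads the power `g ^ 1`: at `g ^ 0` the degree would be `-1`. -/
lemma topCoord_modelA_modelDeg (hpn : p ∣ n) [Fact (2 < p)] (v : Fin p → Fin p → ZMod n → k) :
    topCoord k p n (modelA p n lam (modelDeg k hpn v)) = 0 := by
  have h2 : (2 : k) ≠ 0 := two_ne_of_char k p Fact.out
  have hp : 2 < p := Fact.out
  have e : lastIdx p = ⟨p - 2 + 1, by omega⟩ := by ext; simp [lastIdx]; omega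
  have hc : ((p - 2 : ℕ) : k) = -2 := by
    rw [Nat.cast_sub hp.le, CharP.cast_eq_zero]; simp
  have hs (w : Fin p → ZMod n → k) : baseA p n lam w (lastIdx p) = w ⟨p - 2, by omega⟩ := by
    rw [e, baseA, twistedShift_succ]
  rw [topCoord_apply, modelA, mapEnd_apply, hs]
  simp [modelDeg, baseDeg, hc, h2, -ZMod.castHom_apply]

variable [Fact (2 < p)] [NeZero n]

lemma commute_rep_modelX (hpn : p ∣ n) (x : LiftAlg k p n lam mu) :
    Commute (modelX p n mu) (rep lam mu hpn x) := by
  have h := subalgebra_eq_top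
    ((Subalgebra.centralizer k {modelX p n mu}).comap (rep lam mu hpn)) ?_ ?_ ?_ x
  · exact Subalgebra.mem_centralizer_iff k |>.1 h _ rfl
  all_goals
    refine (Subalgebra.mem_centralizer_iff k).2 ?_
    rintro _ rfl
  · exact (rep_g (lam := lam) (mu := mu) hpn).symm ▸ commute_modelG_modelX.symm.eq
  · exact (rep_a (lam := lam) (mu := mu) hpn).symm ▸ commute_modelA_modelX.symm.eq
  · refine (rep_b (lam := lam) (mu := mu) hpn).symm ▸ Commute.eq ?_
    exact (Commute.refl _).add_right
      (commute_modelA_modelX.symm.mul_right (commute_modelDeg_modelX hpn).symm)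

/-- `X` commutes with the representation and agrees with `b` on powers applied to the cyclic vector,
so it is right multiplication by `b`. -/
lemma orbit_mul_b_pow (hpn : p ∣ n) (x : LiftAlg k p n lam mu) (l : ℕ) :
    orbit lam mu hpn (x * b k p n lam mu ^ l) = (modelX p n mu ^ l) (orbit lam mu hpn x) := by
  rw [orbit_apply, map_mul, map_pow, rep_b, End.mul_apply, modelB_pow_cyclicVector,
    ← End.mul_apply, ← ((commute_rep_modelX hpn x).pow_left l).eq, End.mul_apply, orbit_apply]

variable (lam mu) in
/-- The symmetrizing functional. -/
def traceForm (hpn : p ∣ n) : LiftAlg k p n lam mu →ₗ[k] k := topCoord k p n ∘ₗ orbit lam mu hpn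

lemma traceForm_apply (hpn : p ∣ n) (x : LiftAlg k p n lam mu) :
    traceForm lam mu hpn x = topCoord k p n (orbit lam mu hpn x) := rfl

lemma traceForm_mul_b (hpn : p ∣ n) (x : LiftAlg k p n lam mu) :
    traceForm lam mu hpn (x * b k p n lam mu) = traceForm lam mu hpn (b k p n lam mu * x) := by
  have h := orbit_mul_b_pow hpn x 1
  rw [pow_one, pow_one] at h
  rw [traceForm_apply, traceForm_apply, h, orbit_mul, rep_b, modelB, LinearMap.add_apply, map_add,
    End.mul_apply, topCoord_modelA_modelDeg, add_zero]

-- Moving `b ^ l` past `g` produces corrections only in lower powers of `b`, which are invisible in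
-- the last component.
omit [Fact (2 < p)] [NeZero n] in
lemma modelB_pow_modelG_cyclicVector_last (hpn : p ∣ n) {l : ℕ} (hl : l < p) :
    (modelB lam mu hpn ^ l) (modelG k p n (cyclicVector k p n)) (lastIdx p) =
      (modelX p n mu ^ l) (modelG k p n (cyclicVector k p n)) (lastIdx p) := by
  have hw : ∀ j : Fin p, (j : ℕ) ≠ 0 → modelG k p n (cyclicVector k p n) j = 0 := by
    intro j hj
    rw [cyclicVector, modelG, mapEnd_single, Pi.single_eq_of_ne]
    rintro rfl
    exact hj rfl
  have hl' : l ≤ (lastIdx p : ℕ) := by simp only [lastIdx]; omega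
  have h1 := add_pow_apply_of_le (mu • (1 - baseG k p n ^ p))
    (baseA p n lam * baseDeg k hpn) _ hw l _ hl'
  have h2 := add_pow_apply_of_le (mu • (1 - baseG k p n ^ p)) 0 _ hw l _ hl'
  rw [map_zero, add_zero] at h2
  exact h1.trans h2.symm

lemma traceForm_mul_g (hpn : p ∣ n) (x : LiftAlg k p n lam mu) :
    traceForm lam mu hpn (x * g k p n lam mu) = traceForm lam mu hpn (g k p n lam mu * x) := by
  suffices h : traceForm lam mu hpn ∘ₗ LinearMap.mulRight k (g k p n lam mu) =
      traceForm lam mu hpn ∘ₗ LinearMap.mulLeft k (g k p n lam mu) from LinearMap.congr_fun h x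
  refine LinearMap.ext_on (span_monomials (Fact.out : p.Prime).pos) ?_
  rintro _ ⟨i, j, l, hj, hl, rfl⟩
  have hGA : modelG k p n ^ i * modelA p n lam ^ j =
      mapEnd p (baseG k p n ^ i * baseA p n lam ^ j) := by
    rw [map_mul, map_pow, map_pow, modelG, modelA]
  have hc : modelG k p n * (modelG k p n ^ i * modelA p n lam ^ j * modelX p n mu ^ l) =
      modelG k p n ^ i * modelA p n lam ^ j * modelX p n mu ^ l * modelG k p n := by
    have hGA' : Commute (modelG k p n) (modelA p n lam) := commute_baseG_baseA.map (mapEnd p)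
    exact ((((Commute.refl (modelG k p n)).pow_right i).mul_right
      (hGA'.pow_right j)).mul_right (commute_modelG_modelX.pow_right l)).eq
  -- Both products become `g ^ i * a ^ j`, acting componentwise in the exponent of `b`, applied to
  -- `X ^ l` or `b ^ l` of the vector of `g`; only the last component matters.
  have hL : orbit lam mu hpn (g k p n lam mu * (g k p n lam mu ^ i * a k p n lam mu ^ j *
      b k p n lam mu ^ l)) = mapEnd p (baseG k p n ^ i * baseA p n lam ^ j)
        ((modelX p n mu ^ l) (modelG k p n (cyclicVector k p n))) := by
    rw [orbit_mul, orbit_mul_b_pow, orbit_apply]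
    simp only [map_mul, map_pow, rep_g, rep_a]
    have h := LinearMap.congr_fun hc (cyclicVector k p n)
    simp only [End.mul_apply] at h
    have hX := LinearMap.congr_fun ((commute_modelG_modelX (p := p) (n := n) (mu := mu)).pow_pow i l
      |>.mul_left ((commute_modelA_modelX (lam := lam) (mu := mu)).pow_pow j l)).eq
      (cyclicVector k p n)
    simp only [End.mul_apply] at hX ⊢
    rw [← hX, h]
    rfl
  have hR : orbit lam mu hpn (g k p n lam mu ^ i * a k p n lam mu ^ j * b k p n lam mu ^ l *
      g k p n lam mu) = mapEnd p (baseG k p n ^ i * baseA p n lam ^ j)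
        ((modelB lam mu hpn ^ l) (modelG k p n (cyclicVector k p n))) := by
    rw [← hGA, orbit_apply]
    simp only [map_mul, map_pow, rep_g, rep_a, rep_b, End.mul_apply]
  rw [LinearMap.comp_apply, LinearMap.comp_apply, LinearMap.mulRight_apply,
    LinearMap.mulLeft_apply, traceForm_apply, traceForm_apply, hL, hR, topCoord_apply,
    topCoord_apply, mapEnd_apply, mapEnd_apply, modelB_pow_modelG_cyclicVector_last hpn hl]

/-- The elements which commute with all elements under a functional. -/
def traceCenter {A : Type*} [Ring A] [Algebra k A] (φ : A →ₗ[k] k) : Subalgebra k A where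
  carrier := {y | ∀ x, φ (x * y) = φ (y * x)}
  mul_mem' := by
    intro y z hy hz x
    rw [← mul_assoc, hz, ← mul_assoc, hy, mul_assoc]
  add_mem' := by
    intro y z hy hz x
    rw [mul_add, add_mul, map_add, map_add, hy, hz]
  algebraMap_mem' := by
    intro c x
    rw [Algebra.commutes]

lemma traceForm_comm (hpn : p ∣ n) (x y : LiftAlg k p n lam mu) :
    traceForm lam mu hpn (x * y) = traceForm lam mu hpn (y * x) := by
  have hg : g k p n lam mu ∈ traceCenter (traceForm lam mu hpn) := traceForm_mul_g hpn
  have hb : b k p n lam mu ∈ traceCenter (traceForm lam mu hpn) := traceForm_mul_b hpn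
  refine subalgebra_eq_top (traceCenter (traceForm lam mu hpn)) hg ?_ hb y x
  -- Because `a = g⁻¹ b g - b`, the generator `a` needs no computation of its own.
  have e : a k p n lam mu =
      g k p n lam mu ^ (n - 1) * b k p n lam mu * g k p n lam mu - b k p n lam mu := by
    rw [mul_assoc, good.b_g, ← mul_assoc, pow_mul_g, one_mul, add_sub_cancel_right]
  rw [e]
  exact sub_mem (mul_mem (mul_mem (pow_mem hg _) hb) hg) hb

lemma eq_zero_of_traceForm_mul (hpn : p ∣ n) {x : LiftAlg k p n lam mu}
    (h : ∀ y, traceForm lam mu hpn (x * y) = 0) : x = 0 := by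
  refine orbit_injective hpn ?_
  rw [map_zero]
  funext l j i
  -- By the trace property this tests `g ^ (1 - i) * a ^ (p - 1 - j) * x * b ^ (p - 1 - l)`, whose
  -- top coordinate is the `(l, j, i)` coordinate of `x`.
  have h1 := h (b k p n lam mu ^ (p - 1 - (l : ℕ)) * (g k p n lam mu ^ (1 - i).val *
    a k p n lam mu ^ (p - 1 - (j : ℕ))))
  rw [← mul_assoc, traceForm_comm, traceForm_apply, orbit_mul, orbit_mul_b_pow, map_mul, map_pow,
    map_pow, rep_g, rep_a, End.mul_apply] at h1
  have h2 := topCoord_monomial_apply (lam := lam) (mu := mu) (orbit lam mu hpn x) (1 - i).val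
    ⟨p - 1 - j, by omega⟩ ⟨p - 1 - l, by omega⟩
  simp only at h2
  rw [h1] at h2
  have e (m : Fin p) : (⟨p - 1 - (p - 1 - m), by omega⟩ : Fin p) = m := by ext; simp; omega
  rw [e, e, ZMod.natCast_zmod_val, sub_sub_cancel] at h2
  exact h2.symm

lemma isSymmetricAlg (hpn : p ∣ n) : IsSymmetricAlg k (LiftAlg k p n lam mu) := by
  refine ⟨finiteDimensional hpn, (LinearMap.mul k _).compr₂ (traceForm lam mu hpn), ⟨?_, ?_⟩, ?_, ?_⟩
  · exact fun x hx => eq_zero_of_traceForm_mul hpn hx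
  · exact fun y hy => eq_zero_of_traceForm_mul hpn fun x => (traceForm_comm hpn y x).trans (hy x)
  · intro x y z
    simp [mul_assoc]
  · intro x y
    exact traceForm_comm hpn x y

/-! ### Integrals -/

/-- The elements acting on `x` through the counit form a subalgebra, so the generators suffice. -/
lemma mem_leftIntegrals {x : LiftAlg k p n lam mu} (hg : g k p n lam mu * x = x)
    (ha : a k p n lam mu * x = 0) (hb : b k p n lam mu * x = 0) :
    x ∈ leftIntegrals k (LiftAlg k p n lam mu) := by
  let s : Subalgebra k (LiftAlg k p n lam mu) :=
    { carrier := {h | h * x = Coalgebra.counit (R := k) h • x}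
      mul_mem' := by
        intro y z (hy : y * x = _) (hz : z * x = _)
        change y * z * x = _
        rw [mul_assoc, hz, mul_smul_comm, hy, smul_smul, Bialgebra.counit_mul, mul_comm]
      add_mem' := by
        intro y z (hy : y * x = _) (hz : z * x = _)
        change (y + z) * x = _
        rw [add_mul, hy, hz, map_add, add_smul]
      algebraMap_mem' := by
        intro c
        change algebraMap k _ c * x = _
        rw [Bialgebra.counit_algebraMap, Algebra.smul_def] }
  intro h
  refine subalgebra_eq_top s ?_ ?_ ?_ h
  · change g k p n lam mu * x = _
    rw [hg, counit_g, one_smul]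
  · change a k p n lam mu * x = _
    rw [ha, counit_a, zero_smul]
  · change b k p n lam mu * x = _
    rw [hb, counit_b, zero_smul]

lemma orbit_integral (hpn : p ∣ n) : orbit lam mu hpn (integral k p n lam mu) =
    Pi.single (lastIdx p) (Pi.single (lastIdx p) fun _ => 1) := by
  have h (i : ℕ) := orbit_monomial (lam := lam) (mu := mu) hpn i (lastIdx p) (lastIdx p)
  have e : ((lastIdx p : Fin p) : ℕ) = p - 1 := rfl
  simp only [e] at h
  rw [integral, Finset.sum_mul, Finset.sum_mul, map_sum]
  simp only [h]
  funext l j i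
  by_cases hl : l = lastIdx p
  · subst hl
    by_cases hj : j = lastIdx p
    · subst hj
      simp only [Finset.sum_apply, Pi.single_eq_same]
      rw [Finset.sum_eq_single i.val]
      · simp
      · intro m hm hne
        rw [Pi.single_eq_of_ne]
        rintro rfl
        exact hne (ZMod.val_natCast_of_lt (Finset.mem_range.1 hm)).symm
      · intro hi
        exact absurd (Finset.mem_range.2 (ZMod.val_lt i)) hi
    · simp [hj]
  · simp [hl]

lemma integral_ne_zero (hpn : p ∣ n) : integral k p n lam mu ≠ 0 := by
  intro h
  have h1 := congrFun (congrFun (congrFun (orbit_integral (lam := lam) (mu := mu) hpn)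
    (lastIdx p)) (lastIdx p)) 0
  rw [h] at h1
  simp at h1

-- `a D = D a - a / 2` kills whatever `a` kills.
omit [Fact (2 < p)] [NeZero n] in
lemma modelB_apply_of_modelA (hpn : p ∣ n) {v : Fin p → Fin p → ZMod n → k}
    (hv : modelA p n lam v = 0) : modelB lam mu hpn v = modelX p n mu v := by
  have h := LinearMap.congr_fun (modelDeg_mul_modelA (lam := lam) hpn) v
  simp only [End.mul_apply, LinearMap.add_apply, LinearMap.smul_apply, hv, map_zero, smul_zero,
    add_zero] at h
  rw [modelB, LinearMap.add_apply, End.mul_apply, ← h, add_zero]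

/-- In coordinates `t` is a constant function of `i` placed at the top exponents. Shifting by `a` or
`X` leaves only the wrap-around terms, and `1 - g ^ p` kills constants. -/
lemma integral_mem_leftIntegrals (hpn : p ∣ n) :
    integral k p n lam mu ∈ leftIntegrals k (LiftAlg k p n lam mu) := by
  have hG : ∀ m : ℕ, (gShift k n ^ m) (fun _ => 1) = fun _ => 1 :=
    fun m => funext fun i => gShift_pow_apply m _ i
  have hA : modelA p n lam (Pi.single (lastIdx p) (Pi.single (lastIdx p) fun _ => (1 : k))) =
      0 := by
    rw [modelA, mapEnd_single, Pi.single_eq_zero_iff, baseA, twistedShift_eq_zero_iff]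
    refine ⟨fun j hj => Pi.single_eq_of_ne hj _, ?_⟩
    rw [Pi.single_eq_same, LinearMap.smul_apply, LinearMap.sub_apply, hG, End.one_apply, sub_self,
      smul_zero]
  refine mem_leftIntegrals ?_ ?_ ?_
  all_goals
    refine orbit_injective hpn ?_
    rw [orbit_mul, orbit_integral]
  · rw [rep_g, modelG, mapEnd_single, baseG, mapEnd_single]
    rfl
  · rw [rep_a, map_zero, hA]
  · rw [rep_b, map_zero, modelB_apply_of_modelA hpn hA, modelX, twistedShift_eq_zero_iff]
    refine ⟨fun j hj => Pi.single_eq_of_ne hj _, ?_⟩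
    rw [Pi.single_eq_same, LinearMap.smul_apply, LinearMap.sub_apply, baseG, ← map_pow,
      mapEnd_single, hG, End.one_apply, sub_self, smul_zero]

/-- Invariance under `g` makes the coordinates constant in `i`; annihilation by `a` and then by `b`,
which now acts as `X`, leaves only the top exponents. -/
lemma leftIntegrals_eq_span (hpn : p ∣ n) :
    leftIntegrals k (LiftAlg k p n lam mu) = Submodule.span k {integral k p n lam mu} := by
  refine le_antisymm (fun x hx => ?_)
    ((Submodule.span_singleton_le_iff_mem _ _).2 (integral_mem_leftIntegrals hpn))
  have hg := congrArg (orbit lam mu hpn) (hx (g k p n lam mu))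
  have ha := congrArg (orbit lam mu hpn) (hx (a k p n lam mu))
  have hb := congrArg (orbit lam mu hpn) (hx (b k p n lam mu))
  rw [orbit_mul, counit_g, one_smul, rep_g] at hg
  rw [orbit_mul, counit_a, zero_smul, map_zero, rep_a] at ha
  rw [orbit_mul, counit_b, zero_smul, map_zero, rep_b, modelB_apply_of_modelA hpn ha, modelX,
    twistedShift_eq_zero_iff] at hb
  have ha' := congrFun ha (lastIdx p)
  rw [modelA, mapEnd_apply, Pi.zero_apply, baseA, twistedShift_eq_zero_iff] at ha'
  set v := orbit lam mu hpn x with hv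
  have hconst : ∀ i, v (lastIdx p) (lastIdx p) i = v (lastIdx p) (lastIdx p) 0 := by
    have h1 : gShift k n (v (lastIdx p) (lastIdx p)) = v (lastIdx p) (lastIdx p) :=
      congrFun (congrFun hg (lastIdx p)) (lastIdx p)
    have h2 : ∀ m : ℕ, (gShift k n ^ m) (v (lastIdx p) (lastIdx p)) =
        v (lastIdx p) (lastIdx p) := by
      intro m
      induction m with
      | zero => simp
      | succ m ih => rw [pow_succ, End.mul_apply, h1, ih]
    intro i
    have h3 := congrFun (h2 i.val) i
    rw [gShift_pow_apply, ZMod.natCast_zmod_val, sub_self] at h3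
    exact h3.symm
  refine Submodule.mem_span_singleton.2 ⟨v (lastIdx p) (lastIdx p) 0, orbit_injective hpn ?_⟩
  rw [map_smul, orbit_integral, ← hv]
  funext l j i
  by_cases hl : l = lastIdx p
  · subst hl
    by_cases hj : j = lastIdx p
    · subst hj
      simp [hconst i]
    · simp [hj, ha'.1 j hj]
  · simp [hl, hb.1 l hl]

/-- With `τ` the trace form and `x` a left integral, `τ(x h y) = τ(h y x) = ε(h) ε(y) τ(x) = τ(ε(h)
x y)` for all `y`, so nondegeneracy gives `x h = ε(h) x`. The converse is symmetric. -/
lemma isUnimodular (hpn : p ∣ n) : IsUnimodular k (LiftAlg k p n lam mu) := by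
  refine le_antisymm (fun x hx h => ?_) (fun x hx h => ?_)
  · refine sub_eq_zero.1 (eq_zero_of_traceForm_mul hpn fun y => ?_)
    rw [sub_mul, mul_assoc, map_sub, traceForm_comm, hx, Bialgebra.counit_mul, smul_mul_assoc,
      map_smul, map_smul, traceForm_comm hpn x y, hx, map_smul, smul_smul, sub_self]
  · refine sub_eq_zero.1 (eq_zero_of_traceForm_mul hpn fun y => ?_)
    rw [sub_mul, mul_assoc, map_sub, hx y, mul_smul_comm, map_smul, traceForm_comm hpn h x, hx h,
      smul_mul_assoc, hx y, map_smul, map_smul, map_smul,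
      smul_comm, sub_self]

/-! ### The square of the antipode -/

/-- The unit is `g⁻¹`: for instance `S²(b) = -S(g⁻¹ b) = -S(b) g = g⁻¹ b g`. As `S` reverses
products, `S²` preserves them, so agreement on generators is enough. -/
lemma isInnerMap_antipode_sq : IsInnerMap (fun x : LiftAlg k p n lam mu =>
    HopfAlgebra.antipode k (HopfAlgebra.antipode k x)) := by
  set u := gUnit k p n lam mu
  have hu : HopfAlgebra.antipode k (↑u⁻¹ : LiftAlg k p n lam mu) = u := by
    have h : HopfAlgebra.antipode k ((u : LiftAlg k p n lam mu) * ↑u⁻¹) = 1 := by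
      rw [Units.mul_inv, HopfAlgebra.antipode_one]
    have hg : HopfAlgebra.antipode k (u : LiftAlg k p n lam mu) = ↑u⁻¹ := antipode_g
    rw [HopfAlgebra.antipode_mul_antidistrib, hg, Units.mul_inv_eq_one] at h
    exact h
  let s : Subalgebra k (LiftAlg k p n lam mu) :=
    { carrier := {x | HopfAlgebra.antipode k (HopfAlgebra.antipode k x) = ↑u⁻¹ * x * u}
      mul_mem' := by
        intro x y hx hy
        simp only [Set.mem_ofPred_eq] at hx hy ⊢
        rw [HopfAlgebra.antipode_mul_antidistrib, HopfAlgebra.antipode_mul_antidistrib, hx, hy]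
        simp only [mul_assoc, Units.mul_inv_cancel_left]
      add_mem' := by
        intro x y hx hy
        simp only [Set.mem_ofPred_eq] at hx hy ⊢
        rw [map_add, map_add, hx, hy, mul_add, add_mul]
      algebraMap_mem' := by
        intro c
        simp only [Set.mem_ofPred_eq]
        rw [← Algebra.commutes, mul_assoc, Units.inv_mul, mul_one, Algebra.algebraMap_eq_smul_one,
          map_smul, HopfAlgebra.antipode_one, map_smul, HopfAlgebra.antipode_one] }
  refine ⟨u⁻¹, fun x => ?_⟩
  rw [inv_inv]
  refine subalgebra_eq_top s ?_ ?_ ?_ x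
  · change HopfAlgebra.antipode k (HopfAlgebra.antipode k (g k p n lam mu)) =
      ↑u⁻¹ * (u : LiftAlg k p n lam mu) * u
    rw [antipode_g, hu, Units.inv_mul, one_mul]
  · change HopfAlgebra.antipode k (HopfAlgebra.antipode k (a k p n lam mu)) = _
    rw [antipode_a, map_neg, HopfAlgebra.antipode_mul_antidistrib, hu, antipode_a, neg_mul, neg_neg]
  · change HopfAlgebra.antipode k (HopfAlgebra.antipode k (b k p n lam mu)) = _
    rw [antipode_b, map_neg, HopfAlgebra.antipode_mul_antidistrib, hu, antipode_b, neg_mul, neg_neg]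

end

end LiftAlg

theorem lemma2p3 {k : Type u} [Field k] [IsAlgClosed k] (p n : ℕ) [Fact p.Prime] [CharP k p]
    [Fact (2 < p)] [NeZero n] (hpn : p ∣ n) (lam mu : k) :
    -- `H(λ, μ)` is a symmetric algebra
    IsSymmetricAlg k (LiftAlg k p n lam mu) ∧
    -- the nonzero element `t` spans the left integrals and the right integrals
    LiftAlg.integral k p n lam mu ≠ 0 ∧
    leftIntegrals k (LiftAlg k p n lam mu) = Submodule.span k {LiftAlg.integral k p n lam mu} ∧
    rightIntegrals k (LiftAlg k p n lam mu) = Submodule.span k {LiftAlg.integral k p n lam mu} ∧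
    IsUnimodular k (LiftAlg k p n lam mu) ∧
    -- the square of the antipode is inner
    IsInnerMap (fun x : LiftAlg k p n lam mu =>
      HopfAlgebra.antipode k (HopfAlgebra.antipode k x)) :=
  ⟨LiftAlg.isSymmetricAlg hpn, LiftAlg.integral_ne_zero hpn, LiftAlg.leftIntegrals_eq_span hpn,
    (LiftAlg.isUnimodular hpn).symm.trans (LiftAlg.leftIntegrals_eq_span hpn),
    LiftAlg.isUnimodular hpn, LiftAlg.isInnerMap_antipode_sq⟩
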